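/- **Setting.** $(X,Y)$ is random with $X\in\mathcal X$, $Y\in\{-1,1\}$, $\Pr(Y=1)=\tfrac12$; $g:\mathcal X\to\mathcal Z$ maps into a metric space and $d(x,x')$ denotes the distance of $g(x),g(x')$. Labeling functions $\lambda_1,\dots,\lambda_m:\mathcal X\to\{-1,0,1\}$ ($0$ = abstain) are given. Extending $\lambda_j$ with radius $r_j>0$ means: keep its votes on its support, vote on $B_{r_j}(\lambda_j)=\{x:\lambda_j(x)=0,\ \exists x',\ \lambda_j(x')\ne0,\ d(x,x')\le r_j\}$ by some (possibly randomized) weighting rule, and abstain elsewhere; the result is $\bar\lambda_j$. A family of sources follows the *binary Ising model* if its joint law with $Y$ is that of $Y$ and spin pairs $(v_i^1,v_i^{-1})\in\{-1,1\}^2$ with density proportional to $\exp(\theta_YY+\sum_i\theta_i(v_i^1-v_i^{-1})Y+\sum_i\theta_{i,i}v_i^1v_i^{-1})$, where $(1,-1)$, $(-1,1)$ and equal spins encode the votes $1,-1,0$. The family $\lambda$, and every extended family below, follows such a model. With $(X,Y),(X',Y')$ i.i.d., put $p_{d(r)}=\Pr(d(X,X')\le r)$; $L_{\lambda_j'},L_Y,M_Y$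 take values in $[0,1]$ and satisfy, for all $r>0$ with $p_{d(r)}>0$, $L_{\lambda_j'}(r)\le\Pr(\lambda_j(X)=0,\lambda_j(X')\ne0\mid d(X,X')\le r)$ and $L_Y(r)\le\Pr(Y\ne Y'\mid d(X,X')\le r)\le M_Y(r)$. The risk is $\mathcal R(f)=\mathbb E\,\tfrac12|Y-f|$. **Label model.** For a family $\lambda$ with accuracies $a_i=\Pr(\lambda_i=Y\mid\lambda_i\ne0)$ let $f_{WS}=2\Pr_\mu(\tilde Y=1\mid\lambda)-1$, where $\Pr_\mu(\tilde Y=1\mid \lambda=s)=\Pr(Y=1)\prod_i b_i(s_i)/\Pr(\lambda=s)$ with $b_i(1)=a_i\Pr(\lambda_i\ne0)$, $b_i(-1)=(1-a_i)\Pr(\lambda_i\neq0)$, $b_i(0)=\Pr(\lambda_i=0)$. From $n\ge1$ i.i.d. samples, $\hat f_{WS}$ is the same expression with $\Pr(\lambda=s)$ replaced by its empirical frequency (with the convention $x/0=0$) and $a_i$ by $\hat a_i=\min\{1,\tfrac12(1+|\hat M_{ij}\hat M_{ik}/\hat M_{jk}|^{1/2})\}$, where $\hat M_{ij}$ is the empirical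 mean of $\lambda_i\lambda_j$ over the samples on which both vote and $i,j,k$ is a triplet of distinct indices with the largest possible minimum of the three pairwise overlaps $\Pr(\lambda_i\neq 0,\lambda_j\neq 0)$, etc. Let $o_{\min}=\min_i\max_{j\ne i}\Pr(\lambda_i\ne0,\lambda_j\ne0)$, $c_p=\min_X\Pr(\lambda=\lambda(X))$, $c_2=\mathbb E\Pr_\mu(\tilde Y=1\mid\lambda)$, and let $e_{\min},c_1>0$ be lower bounds for all $\mathbb E[\lambda_iY\mid\lambda_i\ne0]$ and for all $\mathbb E[\lambda_i\lambda_j\mid\lambda_i,\lambda_j\ne0]$, $i\ne j$. Bars ($f_E,\hat f_E,\bar c_p,\bar c_2,\bar e_{\min},\bar c_1$, triplets) denote the same objects for the extended family $\bar\lambda$. **Theorem.** Let $0<\delta<1$ and $\varepsilon_n=\sqrt{\log(2/\delta)/(2n)}$. (1) Let $m\ge3$, let every $\lambda_j$ be extended with radius $r_j>0$, $L_{\min}=\min_jL_{\lambda_j'}(r_j)$, $r_{\min}=\min_jr_j$, and $\varepsilon_n<\bar c_p$. Then there is an event of probability at least $1-\delta$ over the sample, conditionally on which $$\mathbb E|\mathcal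 R(f_E)-\mathcal R(\hat f_E)|\le\frac1{\bar c_p-\varepsilon_n}\left(\frac{81\sqrt\pi}{2\bar e_{\min}\bar c_1^2}\cdot\frac{m}{\sqrt{n\,o_{\min}(1+(2L_{\min}-L_{\min}^2)p_{d(r_{\min})})}}+\varepsilon_n\bar c_2\right).$$ (2) Let $m\ge3$ and $\varepsilon_n<c_p$. Then, in the same sense, $$\mathbb E|\mathcal R(f_{WS})-\mathcal R(\hat f_{WS})|\le\frac1{c_p-\varepsilon_n}\left(\frac{81\sqrt\pi}{2e_{\min}c_1^2}\cdot\frac{m}{\sqrt{n\,o_{\min}}}+\varepsilon_nc_2\right).$$ (3) Let only $\lambda_i$ be extended, with radius $r>0$, and let here $f_E$ denote the model that equals $f_{WS}$ on the support of $\lambda_i$ and the label model of $(\bar\lambda_i,\lambda_{-i})$ elsewhere. Put $p_i=\Pr(\lambda_i\ne0)$, $a_i=\Pr(\lambda_i=Y\mid\lambda_i\ne0)$, $\bar a_i=\Pr(\bar\lambda_i=Y\mid\bar\lambda_i\ne0)$, $\tilde a_i=\Pr(\bar\lambda_i=Y\mid X\in B_r(\lambda_i))$, $p(X)=\Pr(Y=1\mid\lambda_{-i}=\lambda_{-i}(X))$,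 $C=\mathbb E[p(X)\mid Y=1,p(X)\ge\tfrac12]$ and $D=\tfrac12(C+1)(\tilde a_i\bar a_i+(1-\tilde a_i)(1-\bar a_i))-C$. Then $\mathcal R(f_{WS})-\mathcal R(f_E)\ge\Pr(X\in B_r(\lambda_i))\,D$, and, if $D\ge0$, $$\mathcal R(f_{WS})-\mathcal R(f_E)\ge L_{\lambda_i'}(r)\,p_{d(r)}\,p_i\,D.$$ Moreover, if $a_i\ge\tfrac12$, $L_{\lambda_i'}(r)p_{d(r)}>0$ and the weighting rule is one that guarantees $\bar a_i\ge a_i-(2a_i-1)\frac{M_Y(r)}{p_i^2(1+L_{\lambda_i'}(r)p_{d(r)})}$, then $$\tilde a_i\ge\bar a_i-(2a_i-1)\frac{M_Y(r)}{L_{\lambda_i'}(r)\,p_{d(r)}\,p_i^2\,(1+L_{\lambda_i'}(r)p_{d(r)})}.$$ -/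

import Mathlib

open MeasureTheory

noncomputable section

namespace Epoxy

/-! Votes take values in `SignType = {-1, 0, 1}` (`0` is an abstention), the label takes values in
`ℤˣ = {-1, 1}`.  A family of `m` sources is `V : Fin m → Ω → SignType`; a source `lf : 𝒳 → SignType`
evaluated at a random point `X : Ω → 𝒳` gives `fun ω => lf (X ω)`, and `Ω` may carry additional
randomness used by an extended source. -/

/-! ### The binary Ising model -/

/-- The vote encoded by a pair of spins: `(1, -1)` is the vote `1`, `(-1, 1)` is the vote `-1`,
and two equal spins are an abstention. -/
def spinVote (u v : ℤˣ) : SignType :=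
  if u = v then 0 else if u = 1 then 1 else -1

/-- Unnormalized Ising density of the label `y` and the spins `v`. -/
def isingWeight {m : ℕ} (θY : ℝ) (θ θ' : Fin m → ℝ) (y : ℤˣ) (v : Fin m → ℤˣ × ℤˣ) : ℝ :=
  Real.exp (θY * ((y : ℤ) : ℝ)
    + ∑ i, θ i * ((((v i).1 : ℤ) : ℝ) - (((v i).2 : ℤ) : ℝ)) * ((y : ℤ) : ℝ)
    + ∑ i, θ' i * (((v i).1 : ℤ) : ℝ) * (((v i).2 : ℤ) : ℝ))

/-- The vector of votes at a sample point. -/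
def pattern {Ω : Type*} {m : ℕ} (V : Fin m → Ω → SignType) (ω : Ω) : Fin m → SignType :=
  fun i => V i ω

/-- The joint law of the label and the votes is given by a binary Ising model. -/
def IsIsing {Ω : Type*} [MeasurableSpace Ω] (P : Measure Ω) (Y : Ω → ℤˣ) {m : ℕ}
    (V : Fin m → Ω → SignType) : Prop :=
  ∃ (θY : ℝ) (θ θ' : Fin m → ℝ), ∀ (y : ℤˣ) (s : Fin m → SignType),
    P.real {ω | Y ω = y ∧ pattern V ω = s} =
      (∑ v : Fin m → ℤˣ × ℤˣ,
        if (fun i => spinVote (v i).1 (v i).2) = s then isingWeight θY θ θ' y v else 0) /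
      (∑ y' : ℤˣ, ∑ v : Fin m → ℤˣ × ℤˣ, isingWeight θY θ θ' y' v)

/-! ### Population quantities -/

/-- Coverage `Pr(v ≠ 0)`. -/
def coverage {Ω : Type*} [MeasurableSpace Ω] (P : Measure Ω) (v : Ω → SignType) : ℝ :=
  P.real {ω | v ω ≠ 0}

/-- Accuracy `Pr(v = Y | v ≠ 0)`. -/
def accuracy {Ω : Type*} [MeasurableSpace Ω] (P : Measure Ω) (Y : Ω → ℤˣ) (v : Ω → SignType) : ℝ :=
  (ProbabilityTheory.cond P {ω | v ω ≠ 0}).real {ω | ((v ω : SignType) : ℤ) = (Y ω : ℤ)}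

/-- `E[v Y | v ≠ 0]`. -/
def signedAccuracy {Ω : Type*} [MeasurableSpace Ω] (P : Measure Ω) (Y : Ω → ℤˣ)
    (v : Ω → SignType) : ℝ :=
  ∫ ω, ((v ω : SignType) : ℝ) * ((Y ω : ℤ) : ℝ) ∂(ProbabilityTheory.cond P {ω | v ω ≠ 0})

/-- `E[v w | v ≠ 0, w ≠ 0]`. -/
def moment {Ω : Type*} [MeasurableSpace Ω] (P : Measure Ω) (v w : Ω → SignType) : ℝ :=
  ∫ ω, ((v ω : SignType) : ℝ) * ((w ω : SignType) : ℝ)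
    ∂(ProbabilityTheory.cond P {ω | v ω ≠ 0 ∧ w ω ≠ 0})

/-- `Pr(λ = s)`. -/
def patternProb {Ω : Type*} [MeasurableSpace Ω] (P : Measure Ω) {m : ℕ}
    (V : Fin m → Ω → SignType) (s : Fin m → SignType) : ℝ :=
  P.real {ω | pattern V ω = s}

/-- `c_p`, the smallest probability of an attained vector of votes. -/
def minPatternProb {Ω : Type*} [MeasurableSpace Ω] (P : Measure Ω) {m : ℕ}
    (V : Fin m → Ω → SignType) : ℝ :=
  ⨅ ω, patternProb P V (pattern V ω)

/-- Probability that two sources both vote. -/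
def overlap {Ω : Type*} [MeasurableSpace Ω] (P : Measure Ω) {m : ℕ}
    (V : Fin m → Ω → SignType) (i j : Fin m) : ℝ :=
  P.real {ω | V i ω ≠ 0 ∧ V j ω ≠ 0}

/-- The minimal overlap `o_min`. -/
def minOverlap {Ω : Type*} [MeasurableSpace Ω] (P : Measure Ω) {m : ℕ}
    (V : Fin m → Ω → SignType) : ℝ :=
  ⨅ i : Fin m, ⨆ j : {j : Fin m // j ≠ i}, overlap P V i j

/-! ### The label model -/

/-- The model probability of the vote `s` given `Y = 1`, for a source with accuracy `a` and
coverage `c`. -/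
def voteFactor (a c : ℝ) (s : SignType) : ℝ :=
  if s = 1 then a * c else if s = -1 then (1 - a) * c else 1 - c

/-- The probabilistic label `Pr(Ỹ = 1 | λ = s)` of the label model with accuracies `a`, where `q s`
is the value used for `Pr(λ = s)`. -/
def labelProb {Ω : Type*} [MeasurableSpace Ω] (P : Measure Ω) (Y : Ω → ℤˣ) {m : ℕ}
    (V : Fin m → Ω → SignType) (a : Fin m → ℝ) (q : (Fin m → SignType) → ℝ)
    (s : Fin m → SignType) : ℝ :=
  (∏ i, voteFactor (a i) (coverage P (V i)) (s i)) * P.real {ω | Y ω = 1} / q s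

/-- The label model `f = 2 Pr(Ỹ = 1 | λ) - 1` with the population parameters. -/
def labelModel {Ω : Type*} [MeasurableSpace Ω] (P : Measure Ω) (Y : Ω → ℤˣ) {m : ℕ}
    (V : Fin m → Ω → SignType) (ω : Ω) : ℝ :=
  2 * labelProb P Y V (fun i => accuracy P Y (V i)) (patternProb P V) (pattern V ω) - 1

/-- `c₂ = E[Pr(Ỹ = 1 | λ)]`. -/
def meanLabelProb {Ω : Type*} [MeasurableSpace Ω] (P : Measure Ω) (Y : Ω → ℤˣ) {m : ℕ}
    (V : Fin m → Ω → SignType) : ℝ :=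
  ∫ ω, labelProb P Y V (fun i => accuracy P Y (V i)) (patternProb P V) (pattern V ω) ∂P

/-- The risk `E[|Y - f| / 2]`. -/
def risk {Ω : Type*} [MeasurableSpace Ω] (P : Measure Ω) (Y : Ω → ℤˣ) (f : Ω → ℝ) : ℝ :=
  ∫ ω, 1 / 2 * |((Y ω : ℤ) : ℝ) - f ω| ∂P

/-! ### Estimation from a data set `D` -/

/-- Empirical probability of a vector of votes. -/
def empPatternProb {Ω : Type*} {m n : ℕ} (V : Fin m → Ω → SignType) (D : Fin n → Ω)
    (s : Fin m → SignType) : ℝ :=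
  (∑ k, if pattern V (D k) = s then (1 : ℝ) else 0) / n

/-- Empirical version of `moment`; abstentions contribute zero to the numerator. -/
def empMoment {Ω : Type*} {m n : ℕ} (V : Fin m → Ω → SignType) (D : Fin n → Ω)
    (i j : Fin m) : ℝ :=
  (∑ k, ((V i (D k) : SignType) : ℝ) * ((V j (D k) : SignType) : ℝ)) /
    (∑ k, if V i (D k) ≠ 0 ∧ V j (D k) ≠ 0 then (1 : ℝ) else 0)

/-- The smallest of the three pairwise overlaps of a triplet. -/
def tripletOverlap {Ω : Type*} [MeasurableSpace Ω] (P : Measure Ω) {m : ℕ}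
    (V : Fin m → Ω → SignType) (i j k : Fin m) : ℝ :=
  min (overlap P V i j) (min (overlap P V i k) (overlap P V j k))

/-- `t i` is a pair of further sources that makes the smallest overlap of the triplet as large as
possible. -/
def IsTripletChoice {Ω : Type*} [MeasurableSpace Ω] (P : Measure Ω) {m : ℕ}
    (V : Fin m → Ω → SignType) (t : Fin m → Fin m × Fin m) : Prop :=
  ∀ i, ((t i).1 ≠ i ∧ (t i).2 ≠ i ∧ (t i).1 ≠ (t i).2) ∧
    ∀ j k, j ≠ i → k ≠ i → j ≠ k →
      tripletOverlap P V i j k ≤ tripletOverlap P V i (t i).1 (t i).2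

/-- The triplet estimate of the accuracy of source `i`, truncated at `1` so that it is a
probability. -/
def estAccuracy {Ω : Type*} {m n : ℕ} (V : Fin m → Ω → SignType) (t : Fin m → Fin m × Fin m)
    (D : Fin n → Ω) (i : Fin m) : ℝ :=
  min 1 (1 / 2 * (Real.sqrt |empMoment V D i (t i).1 * empMoment V D i (t i).2 /
    empMoment V D (t i).1 (t i).2| + 1))

/-- The label model estimated from the data set `D`. -/
def estLabelModel {Ω : Type*} [MeasurableSpace Ω] (P : Measure Ω) (Y : Ω → ℤˣ) {m n : ℕ}
    (V : Fin m → Ω → SignType) (t : Fin m → Fin m × Fin m) (D : Fin n → Ω) (ω : Ω) : ℝ :=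
  2 * labelProb P Y V (estAccuracy V t D) (empPatternProb V D) (pattern V ω) - 1

/-- The estimation error `|R(f) - R(f̂)|` as a function of the data set. -/
def riskGap {Ω : Type*} [MeasurableSpace Ω] (P : Measure Ω) (Y : Ω → ℤˣ) {m n : ℕ}
    (V : Fin m → Ω → SignType) (t : Fin m → Fin m × Fin m) (D : Fin n → Ω) : ℝ :=
  |risk P Y (labelModel P Y V) - risk P Y (estLabelModel P Y V t D)|

/-- The deviation `ε_n`. -/
def epsn (δ : ℝ) (n : ℕ) : ℝ := Real.sqrt (Real.log (2 / δ) / (2 * n))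

/-- For `n` i.i.d. samples there is an event of probability at least `1 - δ` on which the expected
estimation error is at most `b`. -/
def EstimationErrorAtMost {Ω : Type*} [MeasurableSpace Ω] (P : Measure Ω) (Y : Ω → ℤˣ) {m : ℕ}
    (V : Fin m → Ω → SignType) (t : Fin m → Fin m × Fin m) (n : ℕ) (δ b : ℝ) : Prop :=
  Integrable (fun D : Fin n → Ω => riskGap P Y V t D) (Measure.pi fun _ : Fin n => P) ∧
  ∃ A : Set (Fin n → Ω), MeasurableSet A ∧
    1 - δ ≤ (Measure.pi fun _ : Fin n => P).real A ∧
    ∫ D, riskGap P Y V t D ∂(ProbabilityTheory.cond (Measure.pi fun _ : Fin n => P) A) ≤ b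

/-! ### Embedding distance, Lipschitzness and extension -/

/-- Pairs of sample points whose embeddings are within `r` of each other. -/
def closePairs {Ω 𝒳 𝒵 : Type*} [MetricSpace 𝒵] (X : Ω → 𝒳) (g : 𝒳 → 𝒵) (r : ℝ) : Set (Ω × Ω) :=
  {q | dist (g (X q.1)) (g (X q.2)) ≤ r}

/-- `p_{d(r)}`: two independent points are within `r` of each other. -/
def closeProb {Ω 𝒳 𝒵 : Type*} [MeasurableSpace Ω] [MetricSpace 𝒵] (P : Measure Ω)
    (X : Ω → 𝒳) (g : 𝒳 → 𝒵) (r : ℝ) : ℝ :=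
  (P.prod P).real (closePairs X g r)

/-- The label is `(L, M)`-Lipschitz. -/
def IsLabelLipschitz {Ω 𝒳 𝒵 : Type*} [MeasurableSpace Ω] [MetricSpace 𝒵] (P : Measure Ω)
    (X : Ω → 𝒳) (g : 𝒳 → 𝒵) (Y : Ω → ℤˣ) (L M : ℝ → ℝ) : Prop :=
  (∀ r, L r ∈ Set.Icc (0 : ℝ) 1 ∧ M r ∈ Set.Icc (0 : ℝ) 1) ∧
  ∀ r, 0 < r → closeProb P X g r ≠ 0 →
    L r ≤ (ProbabilityTheory.cond (P.prod P) (closePairs X g r)).real {q | Y q.1 ≠ Y q.2} ∧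
    (ProbabilityTheory.cond (P.prod P) (closePairs X g r)).real {q | Y q.1 ≠ Y q.2} ≤ M r

/-- `L` is a lower Lipschitz function of the support of `lf`: it bounds from below the probability
that the first of two points within `r` is outside the support and the second is inside. -/
def IsSupportLowerLipschitz {Ω 𝒳 𝒵 : Type*} [MeasurableSpace Ω] [MetricSpace 𝒵] (P : Measure Ω)
    (X : Ω → 𝒳) (g : 𝒳 → 𝒵) (lf : 𝒳 → SignType) (L : ℝ → ℝ) : Prop :=
  (∀ r, L r ∈ Set.Icc (0 : ℝ) 1) ∧
  ∀ r, 0 < r → closeProb P X g r ≠ 0 →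
    L r ≤ (ProbabilityTheory.cond (P.prod P) (closePairs X g r)).real
      {q | lf (X q.1) = 0 ∧ lf (X q.2) ≠ 0}

/-- The newly labeled region `B_r(lf)`. -/
def newRegion {𝒳 𝒵 : Type*} [MetricSpace 𝒵] (g : 𝒳 → 𝒵) (r : ℝ) (lf : 𝒳 → SignType) : Set 𝒳 :=
  {x | lf x = 0 ∧ ∃ x', lf x' ≠ 0 ∧ dist (g x) (g x') ≤ r}

/-- `ext` extends `lf` with radius `r`: it keeps the votes of `lf`, votes on `B_r(lf)` (in any way,
so that every weighting rule is covered, including randomized ones), and abstains elsewhere. -/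
structure IsExtension {Ω 𝒳 𝒵 : Type*} [MetricSpace 𝒵] (X : Ω → 𝒳) (g : 𝒳 → 𝒵) (r : ℝ)
    (lf : 𝒳 → SignType) (ext : Ω → SignType) : Prop where
  keeps : ∀ ω, lf (X ω) ≠ 0 → ext ω = lf (X ω)
  votes : ∀ ω, X ω ∈ newRegion g r lf → ext ω ≠ 0
  abstains : ∀ ω, lf (X ω) = 0 → X ω ∉ newRegion g r lf → ext ω = 0

/-! ### Lift from extending one source -/

/-- `ã`: accuracy of the extended source on the newly labeled region. -/
def newAccuracy {Ω 𝒳 𝒵 : Type*} [MeasurableSpace Ω] [MetricSpace 𝒵] (P : Measure Ω)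
    (X : Ω → 𝒳) (Y : Ω → ℤˣ) (g : 𝒳 → 𝒵) (r : ℝ) (lf : 𝒳 → SignType) (ext : Ω → SignType) : ℝ :=
  (ProbabilityTheory.cond P {ω | X ω ∈ newRegion g r lf}).real
    {ω | ((ext ω : SignType) : ℤ) = (Y ω : ℤ)}

/-- `p(X)`: posterior probability of `Y = 1` given the votes of all sources other than `i`. -/
def othersPosterior {Ω : Type*} [MeasurableSpace Ω] (P : Measure Ω) (Y : Ω → ℤˣ) {m : ℕ}
    (V : Fin m → Ω → SignType) (i : Fin m) (ω : Ω) : ℝ :=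
  (ProbabilityTheory.cond P {ω' | ∀ j, j ≠ i → V j ω' = V j ω}).real {ω' | Y ω' = 1}

/-- `C = E[p(X) | Y = 1, p(X) ≥ 1/2]`, the performance of the other sources. -/
def othersPerformance {Ω : Type*} [MeasurableSpace Ω] (P : Measure Ω) (Y : Ω → ℤˣ) {m : ℕ}
    (V : Fin m → Ω → SignType) (i : Fin m) : ℝ :=
  ∫ ω, othersPosterior P Y V i ω
    ∂(ProbabilityTheory.cond P {ω | Y ω = 1 ∧ 1 / 2 ≤ othersPosterior P Y V i ω})

/-- The asymptotic model after extending source `i` to `ext`: the original label model on the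
support of source `i`, and the label model of the extended sources elsewhere. -/
def extendedModel {Ω : Type*} [MeasurableSpace Ω] (P : Measure Ω) (Y : Ω → ℤˣ) {m : ℕ}
    (V : Fin m → Ω → SignType) (i : Fin m) (ext : Ω → SignType) (ω : Ω) : ℝ :=
  if V i ω ≠ 0 then labelModel P Y V ω else labelModel P Y (Function.update V i ext) ω

/-- The factor `½ (C + 1) (ã ā + (1 - ã) (1 - ā)) - C`. -/
def liftFactor (C a' a'' : ℝ) : ℝ :=
  1 / 2 * (C + 1) * (a' * a'' + (1 - a') * (1 - a'')) - C

end Epoxy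

end

/-! Summing out the spins factorizes the Ising density: given `Y` the votes are independent, with
accuracies `a i` and coverages `c i` in the open unit interval, and the coverages do not depend on
the label; balance removes `θY`. This is `HasFactorLaw`, produced by `IsIsing.exists_hasFactorLaw`.
Every population quantity then has a closed form: overlaps are `c i * c j`, conditional moments are
`(2 * a i - 1) * (2 * a j - 1)`, and the label model is the true posterior.

Estimation error. The risk is 1-Lipschitz in the posterior, so the gap is a sum over vote patterns
(`HasFactorLaw.riskGap_le`) of an accuracy error, an empirical frequency error and a rare event.
Second moments give a rate `1/√n` for the first two, via the stability of the triplet formula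
(`abs_triplet_sub_le`). The rare event, a frequency below half its mean, has exponentially small
probability (`measureReal_count_lt_half_le`), which outweighs the value of at most `n` that the
estimate can then take. The sum over patterns costs a factor `2 ^ m`; since each of the `2 ^ m`
patterns without abstention has probability at least `c_p`, every overlap is at least `2 ^ m * c_p`,
and the cost is paid by `1 / c_p`. The outcome bounds the unconditional expectation, and `rate_le`
compares constants, using that `o_min` times the extension factor is at most `2`.

Lift. The two models differ only where the old source abstains and the new one votes. Both families
are factorized and share the other sources, so subtracting the two laws gives the joint law on that
region (`HasFactorLaw.newRegion_law`). For fixed other votes a Cauchy-Schwarz inequality bounds the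
gain (`le_posterior_gain`). Summation, the symmetry between the labels and `E[p(X) | Y = 1] ≤ C`
give `HasFactorLaw.le_lift`, which is stronger than the stated bound. The mass of the new region is
bounded below by close pairs straddling the boundary of the support, and the bound on its accuracy
is a balance of correct votes. -/

noncomputable section

namespace Epoxy

/-! ### Integrals of functions of a finite-valued map, and conditional measures. -/

section FiniteValued

variable {Ω : Type*} [MeasurableSpace Ω] {S : Type*}

theorem measurableSet_finiteValued [Countable S] {W : Ω → S} (hW : ∀ s, MeasurableSet (W ⁻¹' {s}))
    (Q : S → Prop) : MeasurableSet {ω | Q (W ω)} := by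
  have : {ω | Q (W ω)} = ⋃ s ∈ {s | Q s}, W ⁻¹' {s} := by
    ext ω; simp
  rw [this]
  exact MeasurableSet.biUnion (Set.to_countable _) fun s _ => hW s

theorem finiteValued_eq_sum_indicator {Ω : Type*} [Fintype S] (W : Ω → S) (F : S → ℝ) :
    (fun ω => F (W ω)) = fun ω => ∑ s, (W ⁻¹' {s}).indicator (fun _ => F s) ω := by
  funext ω
  rw [Finset.sum_eq_single (W ω)]
  · simp
  · intro s _ hs
    rw [Set.indicator_of_notMem]
    simpa using hs.symm
  · simp

theorem integrable_finiteValued [Fintype S] (P : Measure Ω) [IsFiniteMeasure P] {W : Ω → S}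
    (hW : ∀ s, MeasurableSet (W ⁻¹' {s})) (F : S → ℝ) : Integrable (fun ω => F (W ω)) P := by
  rw [finiteValued_eq_sum_indicator]
  exact integrable_finsetSum _ fun s _ => (integrable_const _).indicator (hW s)

/-- Labels and votes take finitely many values, so every expectation below reduces to a finite sum
over their joint law, and integrability is automatic. -/
theorem integral_finiteValued [Fintype S] (P : Measure Ω) [IsFiniteMeasure P] {W : Ω → S}
    (hW : ∀ s, MeasurableSet (W ⁻¹' {s})) (F : S → ℝ) :
    ∫ ω, F (W ω) ∂P = ∑ s, P.real {ω | W ω = s} * F s := by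
  rw [finiteValued_eq_sum_indicator,
    integral_finsetSum _ fun s _ => (integrable_const _).indicator (hW s)]
  refine Finset.sum_congr rfl fun s _ => ?_
  rw [integral_indicator_const _ (hW s), smul_eq_mul]
  rfl

theorem measureReal_finiteValued [Fintype S] (P : Measure Ω) [IsFiniteMeasure P] {W : Ω → S}
    (hW : ∀ s, MeasurableSet (W ⁻¹' {s})) (Q : S → Prop) [DecidablePred Q] :
    P.real {ω | Q (W ω)} = ∑ s, if Q s then P.real {ω | W ω = s} else 0 := by
  have h := integral_finiteValued P hW fun s => if Q s then (1 : ℝ) else 0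
  have h' : (fun ω => if Q (W ω) then (1 : ℝ) else 0) = {ω | Q (W ω)}.indicator fun _ => 1 := by
    funext ω; simp [Set.indicator]
  rw [h', integral_indicator_const _ (measurableSet_finiteValued hW Q)] at h
  simpa using h

theorem measurableSet_preimage_prodMk {T : Type*} {W : Ω → S} {W' : Ω → T}
    (hW : ∀ s, MeasurableSet (W ⁻¹' {s})) (hW' : ∀ s, MeasurableSet (W' ⁻¹' {s})) (s : S × T) :
    MeasurableSet ((fun ω => (W ω, W' ω)) ⁻¹' {s}) := by
  have : (fun ω => (W ω, W' ω)) ⁻¹' {s} = W ⁻¹' {s.1} ∩ W' ⁻¹' {s.2} := by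
    ext ω; simp [Prod.ext_iff]
  rw [this]
  exact (hW _).inter (hW' _)

theorem integral_cond_eq (P : Measure Ω) (A : Set Ω) (f : Ω → ℝ) :
    ∫ ω, f ω ∂(ProbabilityTheory.cond P A) = (P.real A)⁻¹ * ∫ ω in A, f ω ∂P := by
  rw [ProbabilityTheory.cond, integral_smul_measure, ENNReal.toReal_inv, smul_eq_mul]
  rfl

theorem measureReal_cond_eq (P : Measure Ω) {A : Set Ω} (hA : MeasurableSet A) (B : Set Ω) :
    (ProbabilityTheory.cond P A).real B = (P.real A)⁻¹ * P.real (A ∩ B) := by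
  rw [Measure.real, ProbabilityTheory.cond_apply hA, ENNReal.toReal_mul, ENNReal.toReal_inv]
  rfl

end FiniteValued

/-- The vote `s` relative to the label `y`, i.e. the product `y s`. -/
def relVote (y : ℤˣ) (s : SignType) : SignType := if y = 1 then s else -s

theorem measurableSet_pattern {Ω : Type*} [MeasurableSpace Ω] {m : ℕ} {V : Fin m → Ω → SignType}
    (hV : ∀ j s, MeasurableSet (V j ⁻¹' {s})) (s : Fin m → SignType) :
    MeasurableSet (pattern V ⁻¹' {s}) := by
  have : pattern V ⁻¹' {s} = ⋂ j, V j ⁻¹' {s j} := by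
    ext ω; simp [pattern, funext_iff]
  rw [this]
  exact MeasurableSet.iInter fun j => hV j _

theorem sum_signType (f : SignType → ℝ) : ∑ s, f s = f 0 + f (-1) + f 1 := by
  rw [show (Finset.univ : Finset SignType) = {0, -1, 1} from rfl]
  rw [Finset.sum_insert (by decide), Finset.sum_insert (by decide), Finset.sum_singleton]; ring

theorem sum_units_int (f : ℤˣ → ℝ) : ∑ y, f y = f 1 + f (-1) := by
  rw [show (Finset.univ : Finset ℤˣ) = {1, -1} from rfl]
  rw [Finset.sum_insert (by decide), Finset.sum_singleton]

theorem sum_voteFactor (a c : ℝ) (y : ℤˣ) : ∑ s, voteFactor a c (relVote y s) = 1 := by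
  rw [sum_signType]
  rcases Int.units_eq_one_or y with rfl | rfl <;>
    simp [relVote, voteFactor, show ((-1 : ℤˣ) = 1) = False by decide] <;> ring

/-- The law of a label and of votes that are independent given the label, with coverages
independent of the label and accuracies `a`. -/
def HasFactorLaw {Ω : Type*} [MeasurableSpace Ω] (P : Measure Ω) (Y : Ω → ℤˣ) {m : ℕ}
    (V : Fin m → Ω → SignType) (a c : Fin m → ℝ) : Prop :=
  (∀ i, 0 < a i ∧ a i < 1 ∧ 0 < c i ∧ c i < 1) ∧
  ∀ (y : ℤˣ) (s : Fin m → SignType), P.real {ω | Y ω = y ∧ pattern V ω = s} =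
    1 / 2 * ∏ i, voteFactor (a i) (c i) (relVote y (s i))

/-! ### The Ising law as conditional independence of the votes given the label. -/

section Ising

variable {Ω : Type*} [MeasurableSpace Ω] {P : Measure Ω} [IsProbabilityMeasure P]
  {Y : Ω → ℤˣ} {m : ℕ} {V : Fin m → Ω → SignType}

/-- The contribution of one source to the Ising density. -/
def spinWeight (θ θ' : ℝ) (y : ℤˣ) (v : ℤˣ × ℤˣ) : ℝ :=
  Real.exp (θ * (((v.1 : ℤ) : ℝ) - ((v.2 : ℤ) : ℝ)) * ((y : ℤ) : ℝ)
    + θ' * ((v.1 : ℤ) : ℝ) * ((v.2 : ℤ) : ℝ))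

theorem isingWeight_eq_prod (θY : ℝ) (θ θ' : Fin m → ℝ) (y : ℤˣ) (v : Fin m → ℤˣ × ℤˣ) :
    isingWeight θY θ θ' y v =
      Real.exp (θY * ((y : ℤ) : ℝ)) * ∏ i, spinWeight (θ i) (θ' i) y (v i) := by
  simp only [isingWeight, spinWeight, ← Real.exp_sum, ← Real.exp_add, Finset.sum_add_distrib]
  ring_nf

/-- Normalization of the spin weights of one source. -/
def spinTotal (θ θ' : ℝ) : ℝ :=
  Real.exp (2 * θ - θ') + Real.exp (-2 * θ - θ') + 2 * Real.exp θ'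

/-- Coverage of a source in terms of its Ising parameters. -/
def spinCoverage (θ θ' : ℝ) : ℝ :=
  (Real.exp (2 * θ - θ') + Real.exp (-2 * θ - θ')) / spinTotal θ θ'

/-- Accuracy of a source in terms of its Ising parameters. -/
def spinAccuracy (θ θ' : ℝ) : ℝ :=
  Real.exp (2 * θ - θ') / (Real.exp (2 * θ - θ') + Real.exp (-2 * θ - θ'))

theorem spinTotal_pos (θ θ' : ℝ) : 0 < spinTotal θ θ' := by
  unfold spinTotal; positivity

theorem spin_bounds (θ θ' : ℝ) : 0 < spinAccuracy θ θ' ∧ spinAccuracy θ θ' < 1 ∧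
    0 < spinCoverage θ θ' ∧ spinCoverage θ θ' < 1 := by
  have h1 := Real.exp_pos (2 * θ - θ')
  have h2 := Real.exp_pos (-2 * θ - θ')
  have h3 := Real.exp_pos θ'
  have := spinTotal_pos θ θ'
  refine ⟨by unfold spinAccuracy; positivity, ?_, by unfold spinCoverage; positivity, ?_⟩
  · unfold spinAccuracy
    rw [div_lt_one (by positivity)]; linarith
  · unfold spinCoverage
    rw [div_lt_one this, spinTotal]; linarith

/-- Unequal spins contribute `exp (±2θ - θ')`, the sign being that of vote times label, and equal
spins arise in two ways and contribute `2 * exp θ'`. The total is the same for both labels, which is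
why coverage does not depend on `y`. -/
theorem sum_spinWeight (θ θ' : ℝ) (y : ℤˣ) (t : SignType) :
    ∑ v : ℤˣ × ℤˣ, (if spinVote v.1 v.2 = t then spinWeight θ θ' y v else 0) =
      spinTotal θ θ' * voteFactor (spinAccuracy θ θ') (spinCoverage θ θ') (relVote y t) := by
  have h1 := Real.exp_pos (2 * θ - θ')
  have h2 := Real.exp_pos (-2 * θ - θ')
  have hne := (spinTotal_pos θ θ').ne'
  have e1 : spinTotal θ θ' * (spinAccuracy θ θ' * spinCoverage θ θ') = Real.exp (2 * θ - θ') := by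
    unfold spinAccuracy spinCoverage; field_simp
  have e3 : spinTotal θ θ' * (1 - spinCoverage θ θ') = 2 * Real.exp θ' := by
    have : spinTotal θ θ' * spinCoverage θ θ' =
      Real.exp (2 * θ - θ') + Real.exp (-2 * θ - θ') := by unfold spinCoverage; field_simp
    rw [mul_sub, this, spinTotal]; ring
  have e2 : spinTotal θ θ' * ((1 - spinAccuracy θ θ') * spinCoverage θ θ') =
      Real.exp (-2 * θ - θ') := by
    have : spinTotal θ θ' * ((1 - spinAccuracy θ θ') * spinCoverage θ θ') =
      spinTotal θ θ' - spinTotal θ θ' * (1 - spinCoverage θ θ') -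
        spinTotal θ θ' * (spinAccuracy θ θ' * spinCoverage θ θ') := by ring
    rw [this, e1, e3, spinTotal]; ring
  have n1 : ((-1 : ℤˣ) = 1) = False := by decide
  have n2 : ((1 : ℤˣ) = -1) = False := by decide
  have n3 : ((1 : SignType) = -1) = False := by decide
  have n4 : ((0 : SignType) = -1) = False := by decide
  have n5 : ((-1 : SignType) = 0) = False := by decide
  have n6 : ((-1 : SignType) = 1) = False := by decide
  rw [Fintype.sum_prod_type]
  simp only [sum_units_int]
  rcases Int.units_eq_one_or y with rfl | rfl <;> cases t <;>
    simp [spinVote, relVote, voteFactor, n1, n2, n3, n4, n5, n6, e1, e2, e3, spinWeight] <;>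
    ring_nf

theorem sum_prod_voteFactor (a c : Fin m → ℝ) (y : ℤˣ) :
    ∑ s : Fin m → SignType, ∏ i, voteFactor (a i) (c i) (relVote y (s i)) = 1 := by
  rw [← Fintype.prod_sum fun i t => voteFactor (a i) (c i) (relVote y t)]
  simp [sum_voteFactor]

/-- The density is a product over sources, so summing over the spins compatible with a pattern also
gives a product. Only the prefactor depends on `θY`, and balance forces it to be `1 / 2` for each
label. -/
theorem IsIsing.exists_hasFactorLaw (h : IsIsing P Y V)
    (hY : ∀ y, MeasurableSet (Y ⁻¹' {y})) (hV : ∀ j s, MeasurableSet (V j ⁻¹' {s}))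
    (hb : P.real {ω | Y ω = 1} = 1 / 2) : ∃ a c, HasFactorLaw P Y V a c := by
  obtain ⟨θY, θ, θ', h⟩ := h
  set a := fun i => spinAccuracy (θ i) (θ' i)
  set c := fun i => spinCoverage (θ i) (θ' i)
  set Z := ∏ i, spinTotal (θ i) (θ' i)
  have hZ : 0 < Z := Finset.prod_pos fun i _ => spinTotal_pos _ _
  set ey : ℤˣ → ℝ := fun y => Real.exp (θY * ((y : ℤ) : ℝ))
  have hnum : ∀ y s, (∑ v : Fin m → ℤˣ × ℤˣ,
      if (fun i => spinVote (v i).1 (v i).2) = s then isingWeight θY θ θ' y v else 0) =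
      ey y * Z * ∏ i, voteFactor (a i) (c i) (relVote y (s i)) := by
    intro y s
    rw [mul_assoc, ← Finset.prod_mul_distrib]
    simp only [a, c, ← sum_spinWeight]
    rw [Fintype.prod_sum, Finset.mul_sum]
    refine Finset.sum_congr rfl fun v _ => ?_
    split_ifs with hs
    · subst hs
      simp [isingWeight_eq_prod, ey]
    · obtain ⟨i, hi⟩ := Function.ne_iff.1 hs
      rw [Finset.prod_eq_zero (Finset.mem_univ i) (if_neg hi), mul_zero]
  -- The normalization is the numerator summed over all patterns, because each spin configuration
  -- encodes exactly one pattern.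
  have hden : ∀ y, ∑ v : Fin m → ℤˣ × ℤˣ, isingWeight θY θ θ' y v = ey y * Z := by
    intro y
    have := Finset.sum_congr rfl fun s (_ : s ∈ Finset.univ) => hnum y s
    rw [← Finset.mul_sum, sum_prod_voteFactor, mul_one, Finset.sum_comm] at this
    simpa using this
  have hpat := measurableSet_pattern hV
  have hlaw : ∀ y s, P.real {ω | Y ω = y ∧ pattern V ω = s} =
      ey y / (∑ y', ey y') * ∏ i, voteFactor (a i) (c i) (relVote y (s i)) := by
    intro y s
    rw [h, hnum, Finset.sum_congr rfl fun y' _ => hden y', ← Finset.sum_mul]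
    field_simp
  have hone : ey 1 / (∑ y', ey y') = 1 / 2 := by
    rw [← hb]
    have := measureReal_finiteValued P (measurableSet_preimage_prodMk hY hpat) fun w => w.1 = 1
    rw [this, Fintype.sum_prod_type]
    simp only [Prod.mk.injEq, hlaw, sum_units_int, show ((-1 : ℤˣ) = 1) = False by decide, if_true,
      if_false, Finset.sum_const_zero, add_zero]
    rw [← Finset.mul_sum, sum_prod_voteFactor, mul_one]
  have hpos : ∀ y, 0 < ey y := fun y => Real.exp_pos _
  have hmone : ey (-1) / (∑ y', ey y') = 1 / 2 := by
    rw [sum_units_int] at hone ⊢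
    have := hpos 1
    have := hpos (-1)
    field_simp at hone ⊢
    linarith
  refine ⟨a, c, fun i => spin_bounds _ _, fun y s => ?_⟩
  rw [hlaw]
  rcases Int.units_eq_one_or y with rfl | rfl
  · rw [hone]
  · rw [hmone]

end Ising

section Ising

variable {Ω : Type*} [MeasurableSpace Ω] {P : Measure Ω} [IsProbabilityMeasure P]
  {Y : Ω → ℤˣ} {m : ℕ} {V : Fin m → Ω → SignType} {a c : Fin m → ℝ}

/-- Coordinates outside `T` sum out to `1` by `sum_voteFactor`. -/
theorem HasFactorLaw.marginal (h : HasFactorLaw P Y V a c)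
    (hY : ∀ y, MeasurableSet (Y ⁻¹' {y})) (hV : ∀ j s, MeasurableSet (V j ⁻¹' {s}))
    (T : Finset (Fin m)) (y : ℤˣ) (u : Fin m → SignType) :
    P.real {ω | Y ω = y ∧ ∀ j ∈ T, V j ω = u j} =
      1 / 2 * ∏ j ∈ T, voteFactor (a j) (c j) (relVote y (u j)) := by
  have h1 := measureReal_finiteValued P (measurableSet_preimage_prodMk hY (measurableSet_pattern hV))
    fun w => w.1 = y ∧ ∀ j ∈ T, w.2 j = u j
  rw [show {ω | Y ω = y ∧ ∀ j ∈ T, V j ω = u j} = {ω | (Y ω, pattern V ω).1 = y ∧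
    ∀ j ∈ T, (Y ω, pattern V ω).2 j = u j} from rfl, h1, Fintype.sum_prod_type,
    Finset.sum_eq_single y (fun y' _ hy' => by simp [hy'])
    (fun hy' => absurd (Finset.mem_univ y) hy')]
  simp only [Prod.mk.injEq, h.2, true_and]
  -- The constraint on the coordinates in `T` is absorbed into the factors, so that the sum over
  -- patterns becomes a product of one-coordinate sums.
  have h2 : ∀ s : Fin m → SignType, (if ∀ j ∈ T, s j = u j then
      1 / 2 * ∏ i, voteFactor (a i) (c i) (relVote y (s i)) else 0) = 1 / 2 *
      ∏ i, if i ∈ T → s i = u i then voteFactor (a i) (c i) (relVote y (s i)) else 0 := by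
    intro s
    split_ifs with hs
    · rw [Finset.prod_congr rfl fun i _ => (if_pos (hs i)).symm]
    · push Not at hs
      obtain ⟨i, hi, hne⟩ := hs
      rw [Finset.prod_eq_zero (Finset.mem_univ i), mul_zero]
      simp [hi, hne]
  rw [Finset.sum_congr rfl fun s _ => h2 s, ← Finset.mul_sum,
    ← Fintype.prod_sum fun i t => if i ∈ T → t = u i then voteFactor (a i) (c i) (relVote y t) else 0]
  congr 1
  rw [← Finset.prod_subset (Finset.subset_univ T)]
  · refine Finset.prod_congr rfl fun i hi => ?_
    simp [hi]
  · intro i _ hi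
    simp [hi, sum_voteFactor]

theorem HasFactorLaw.marginal_single (h : HasFactorLaw P Y V a c)
    (hY : ∀ y, MeasurableSet (Y ⁻¹' {y})) (hV : ∀ j s, MeasurableSet (V j ⁻¹' {s}))
    (i : Fin m) (y : ℤˣ) (t : SignType) :
    P.real {ω | (Y ω, V i ω) = (y, t)} = 1 / 2 * voteFactor (a i) (c i) (relVote y t) := by
  simpa using h.marginal hY hV {i} y fun _ => t

theorem HasFactorLaw.marginal_pair (h : HasFactorLaw P Y V a c)
    (hY : ∀ y, MeasurableSet (Y ⁻¹' {y})) (hV : ∀ j s, MeasurableSet (V j ⁻¹' {s}))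
    {i j : Fin m} (hij : i ≠ j) (y : ℤˣ) (t t' : SignType) :
    P.real {ω | (Y ω, V i ω, V j ω) = (y, t, t')} = 1 / 2 *
      (voteFactor (a i) (c i) (relVote y t) * voteFactor (a j) (c j) (relVote y t')) := by
  have := h.marginal hY hV {i, j} y fun k => if k = i then t else t'
  rw [Finset.prod_pair hij] at this
  simpa [hij.symm] using this

theorem HasFactorLaw.sum_single (h : HasFactorLaw P Y V a c)
    (hY : ∀ y, MeasurableSet (Y ⁻¹' {y})) (hV : ∀ j s, MeasurableSet (V j ⁻¹' {s}))
    (i : Fin m) (F : ℤˣ → SignType → ℝ) :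
    ∫ ω, F (Y ω) (V i ω) ∂P =
      ∑ y, ∑ t, 1 / 2 * voteFactor (a i) (c i) (relVote y t) * F y t := by
  rw [integral_finiteValued P (measurableSet_preimage_prodMk hY (hV i)) fun w => F w.1 w.2,
    Fintype.sum_prod_type]
  simp only [h.marginal_single hY hV]

theorem HasFactorLaw.sum_pair (h : HasFactorLaw P Y V a c)
    (hY : ∀ y, MeasurableSet (Y ⁻¹' {y})) (hV : ∀ j s, MeasurableSet (V j ⁻¹' {s}))
    {i j : Fin m} (hij : i ≠ j) (F : SignType → SignType → ℝ) :
    ∫ ω, F (V i ω) (V j ω) ∂P =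
      ∑ y, ∑ t, ∑ t', 1 / 2 * (voteFactor (a i) (c i) (relVote y t) *
        voteFactor (a j) (c j) (relVote y t')) * F t t' := by
  rw [integral_finiteValued P (measurableSet_preimage_prodMk hY
    (measurableSet_preimage_prodMk (hV i) (hV j))) fun w => F w.2.1 w.2.2, Fintype.sum_prod_type]
  simp only [Fintype.sum_prod_type, h.marginal_pair hY hV hij]

theorem measureReal_eq_integral {Ω : Type*} [MeasurableSpace Ω] {P : Measure Ω}
    [IsFiniteMeasure P] {Q : Ω → Prop} [DecidablePred Q] (hQ : MeasurableSet {ω | Q ω}) :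
    P.real {ω | Q ω} = ∫ ω, (if Q ω then 1 else 0) ∂P := by
  have h' : (fun ω => if Q ω then (1 : ℝ) else 0) = {ω | Q ω}.indicator fun _ => 1 := by
    funext ω; simp [Set.indicator]
  rw [h', integral_indicator_const _ hQ]; simp

theorem HasFactorLaw.coverage_eq (h : HasFactorLaw P Y V a c)
    (hY : ∀ y, MeasurableSet (Y ⁻¹' {y})) (hV : ∀ j s, MeasurableSet (V j ⁻¹' {s}))
    (i : Fin m) : coverage P (V i) = c i := by
  rw [coverage, measureReal_eq_integral (measurableSet_finiteValued (hV i) fun s => s ≠ 0),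
    h.sum_single hY hV i fun _ t => if t ≠ 0 then 1 else 0]
  simp only [sum_units_int, sum_signType]
  simp [relVote, voteFactor, show ((-1 : ℤˣ) = 1) = False by decide]
  ring

theorem HasFactorLaw.accuracy_eq (h : HasFactorLaw P Y V a c)
    (hY : ∀ y, MeasurableSet (Y ⁻¹' {y})) (hV : ∀ j s, MeasurableSet (V j ⁻¹' {s}))
    (i : Fin m) : accuracy P Y (V i) = a i := by
  have hm : MeasurableSet {ω | V i ω ≠ 0} := measurableSet_finiteValued (hV i) fun s => s ≠ 0
  have hW := measurableSet_preimage_prodMk hY (hV i)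
  have hm2 : MeasurableSet {ω | V i ω ≠ 0 ∧ ((V i ω : SignType) : ℤ) = (Y ω : ℤ)} :=
    measurableSet_finiteValued hW fun w => w.2 ≠ 0 ∧ ((w.2 : SignType) : ℤ) = (w.1 : ℤ)
  rw [accuracy, measureReal_cond_eq P hm, ← coverage, h.coverage_eq hY hV, ← Set.ofPred_and,
    measureReal_eq_integral hm2,
    h.sum_single hY hV i fun y t => if t ≠ 0 ∧ ((t : SignType) : ℤ) = (y : ℤ) then 1 else 0]
  have := (h.1 i).2.2.1
  simp only [sum_units_int, sum_signType]
  simp [relVote, voteFactor, show ((-1 : ℤˣ) = 1) = False by decide]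
  field_simp
  ring

theorem HasFactorLaw.signedAccuracy_eq (h : HasFactorLaw P Y V a c)
    (hY : ∀ y, MeasurableSet (Y ⁻¹' {y})) (hV : ∀ j s, MeasurableSet (V j ⁻¹' {s}))
    (i : Fin m) : signedAccuracy P Y (V i) = 2 * a i - 1 := by
  rw [signedAccuracy, integral_cond_eq, ← coverage, h.coverage_eq hY hV,
    setIntegral_eq_integral_of_forall_compl_eq_zero (by intro ω hω; simp_all),
    h.sum_single hY hV i fun y t => ((t : SignType) : ℝ) * ((y : ℤ) : ℝ)]
  have := (h.1 i).2.2.1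
  simp only [sum_units_int, sum_signType]
  simp [relVote, voteFactor, show ((-1 : ℤˣ) = 1) = False by decide]
  field_simp
  ring

theorem HasFactorLaw.overlap_eq (h : HasFactorLaw P Y V a c)
    (hY : ∀ y, MeasurableSet (Y ⁻¹' {y})) (hV : ∀ j s, MeasurableSet (V j ⁻¹' {s}))
    {i j : Fin m} (hij : i ≠ j) : overlap P V i j = c i * c j := by
  rw [overlap, measureReal_eq_integral (measurableSet_finiteValued
    (measurableSet_preimage_prodMk (hV i) (hV j)) fun w => w.1 ≠ 0 ∧ w.2 ≠ 0),
    h.sum_pair hY hV hij fun t t' => if t ≠ 0 ∧ t' ≠ 0 then 1 else 0]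
  simp only [sum_units_int, sum_signType]
  simp [relVote, voteFactor, show ((-1 : ℤˣ) = 1) = False by decide]
  ring

theorem HasFactorLaw.integral_mul_eq (h : HasFactorLaw P Y V a c)
    (hY : ∀ y, MeasurableSet (Y ⁻¹' {y})) (hV : ∀ j s, MeasurableSet (V j ⁻¹' {s}))
    {i j : Fin m} (hij : i ≠ j) : ∫ ω, ((V i ω : SignType) : ℝ) * ((V j ω : SignType) : ℝ) ∂P =
      c i * c j * ((2 * a i - 1) * (2 * a j - 1)) := by
  rw [h.sum_pair hY hV hij fun t t' => ((t : SignType) : ℝ) * ((t' : SignType) : ℝ)]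
  simp only [sum_units_int, sum_signType]
  simp [relVote, voteFactor, show ((-1 : ℤˣ) = 1) = False by decide]
  ring

/-- Since `Y ^ 2 = 1`, conditional independence factors the moment into signed accuracies. This is
the identity on which the triplet estimate rests. -/
theorem HasFactorLaw.moment_eq (h : HasFactorLaw P Y V a c)
    (hY : ∀ y, MeasurableSet (Y ⁻¹' {y})) (hV : ∀ j s, MeasurableSet (V j ⁻¹' {s}))
    {i j : Fin m} (hij : i ≠ j) :
    moment P (V i) (V j) = (2 * a i - 1) * (2 * a j - 1) := by
  rw [moment, integral_cond_eq,
    show P.real {ω | V i ω ≠ 0 ∧ V j ω ≠ 0} = overlap P V i j from rfl, h.overlap_eq hY hV hij,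
    setIntegral_eq_integral_of_forall_compl_eq_zero (by
      intro ω hω
      simp only [Set.mem_ofPred_eq, not_and_or, not_not] at hω
      rcases hω with hω | hω <;> simp [hω]), h.integral_mul_eq hY hV hij]
  have := (h.1 i).2.2.1
  have := (h.1 j).2.2.1
  field_simp

theorem HasFactorLaw.patternProb_eq (h : HasFactorLaw P Y V a c)
    (hY : ∀ y, MeasurableSet (Y ⁻¹' {y})) (hV : ∀ j s, MeasurableSet (V j ⁻¹' {s}))
    (s : Fin m → SignType) : patternProb P V s =
      1 / 2 * ∏ i, voteFactor (a i) (c i) (s i) +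
        1 / 2 * ∏ i, voteFactor (a i) (c i) (relVote (-1) (s i)) := by
  have h1 := measureReal_finiteValued P (measurableSet_preimage_prodMk hY (measurableSet_pattern hV))
    fun w => w.2 = s
  rw [patternProb, show {ω | pattern V ω = s} = {ω | (Y ω, pattern V ω).2 = s} from rfl, h1,
    Fintype.sum_prod_type]
  simp only [Finset.sum_ite_eq', Finset.mem_univ, if_true, Prod.mk.injEq, h.2, sum_units_int]
  simp [relVote]

theorem voteFactor_pos {a c : ℝ} (h : 0 < a ∧ a < 1 ∧ 0 < c ∧ c < 1) (s : SignType) :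
    0 < voteFactor a c s := by
  have h1 : 0 < 1 - a := by linarith
  have h2 : 0 < 1 - c := by linarith
  obtain ⟨h3, -, h4, -⟩ := h
  unfold voteFactor
  split_ifs <;> positivity

theorem HasFactorLaw.patternProb_pos (h : HasFactorLaw P Y V a c)
    (hY : ∀ y, MeasurableSet (Y ⁻¹' {y})) (hV : ∀ j s, MeasurableSet (V j ⁻¹' {s}))
    (s : Fin m → SignType) : 0 < patternProb P V s := by
  rw [h.patternProb_eq hY hV]
  have := Finset.prod_pos fun i (_ : i ∈ Finset.univ) => voteFactor_pos (h.1 i) (s i)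
  have := Finset.prod_pos fun i (_ : i ∈ Finset.univ) =>
    voteFactor_pos (h.1 i) (relVote (-1) (s i))
  positivity

theorem minPatternProb_le {Ω : Type*} [MeasurableSpace Ω] {P : Measure Ω} {m : ℕ}
    {V : Fin m → Ω → SignType} (s : Fin m → SignType) (hs : 0 < patternProb P V s) :
    minPatternProb P V ≤ patternProb P V s := by
  have : ({ω | pattern V ω = s}).Nonempty := by
    by_contra hne
    rw [Set.not_nonempty_iff_eq_empty] at hne
    simp [patternProb, hne] at hs
  obtain ⟨ω, hω⟩ := this
  have hb : BddBelow (Set.range fun ω => patternProb P V (pattern V ω)) :=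
    ⟨0, by rintro _ ⟨ω, rfl⟩; exact measureReal_nonneg⟩
  have := ciInf_le hb ω
  rwa [show pattern V ω = s from hω] at this

/-- The true posterior of `Y = 1` given the votes. -/
theorem HasFactorLaw.labelProb_eq (h : HasFactorLaw P Y V a c)
    (hY : ∀ y, MeasurableSet (Y ⁻¹' {y})) (hV : ∀ j s, MeasurableSet (V j ⁻¹' {s}))
    (hb : P.real {ω | Y ω = 1} = 1 / 2) (s : Fin m → SignType) :
    labelProb P Y V (fun i => accuracy P Y (V i)) (patternProb P V) s =
      1 / 2 * (∏ i, voteFactor (a i) (c i) (s i)) / patternProb P V s := by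
  simp only [labelProb, h.accuracy_eq hY hV, h.coverage_eq hY hV, hb]
  ring

end Ising

/-! ### Moment and tail bounds for i.i.d. samples. -/

section Sample

variable {Ω : Type*} [MeasurableSpace Ω] {P : Measure Ω} [IsProbabilityMeasure P] {n : ℕ}

theorem measurableSet_sample {S : Type*} {W : Ω → S} (hW : ∀ s, MeasurableSet (W ⁻¹' {s}))
    (s : Fin n → S) : MeasurableSet ((fun (D : Fin n → Ω) k => W (D k)) ⁻¹' {s}) := by
  have : (fun (D : Fin n → Ω) k => W (D k)) ⁻¹' {s} =
      ⋂ k, (fun D : Fin n → Ω => D k) ⁻¹' (W ⁻¹' {s k}) := by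
    ext ω; simp [funext_iff]
  rw [this]
  exact MeasurableSet.iInter fun k => measurable_pi_apply k (hW _)

theorem integrable_sample (P : Measure Ω) [IsProbabilityMeasure P] {S : Type*} [Finite S]
    {W : Ω → S} (hW : ∀ s, MeasurableSet (W ⁻¹' {s})) (F : (Fin n → S) → ℝ) :
    Integrable (fun D : Fin n → Ω => F fun k => W (D k)) (Measure.pi fun _ : Fin n => P) := by
  have := Fintype.ofFinite S
  exact integrable_finiteValued _ (measurableSet_sample hW) F

/-- `E|S| ≤ √E[S²]`, and for independent centred summands `E[S²]` is `n` times the single variance.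
-/
theorem integral_abs_sum_sample_le {Z : Ω → ℝ} (hZ : MemLp Z 2 P) (h0 : ∫ ω, Z ω ∂P = 0)
    {v : ℝ} (hv : ∫ ω, Z ω ^ 2 ∂P ≤ v) :
    ∫ D : Fin n → Ω, |∑ k, Z (D k)| ∂(Measure.pi fun _ => P) ≤ Real.sqrt (n * v) := by
  set μ : Measure (Fin n → Ω) := Measure.pi fun _ => P
  have hcoord : ∀ k : Fin n, MemLp (fun D : Fin n → Ω => Z (D k)) 2 μ := fun k =>
    hZ.comp_measurePreserving (measurePreserving_eval (fun _ : Fin n => P) k)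
  have hS : MemLp (fun D : Fin n → Ω => ∑ k, Z (D k)) 2 μ := memLp_finsetSum _ fun k _ => hcoord k
  have hmean : ∫ D : Fin n → Ω, ∑ k, Z (D k) ∂μ = 0 := by
    rw [integral_finsetSum _ fun k _ => (hcoord k).integrable (by norm_num)]
    refine Finset.sum_eq_zero fun k _ => ?_
    rw [← h0]
    exact integral_comp_eval (μ := fun _ : Fin n => P) hZ.aestronglyMeasurable
  have hvarZ : ProbabilityTheory.variance Z P = ∫ ω, Z ω ^ 2 ∂P := by
    rw [ProbabilityTheory.variance_eq_sub hZ, h0]; simp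
  have hvar := ProbabilityTheory.variance_sum_pi (μ := fun _ : Fin n => P) (X := fun _ => Z)
    fun _ => hZ
  have hsum : (∑ k : Fin n, fun D : Fin n → Ω => Z (D k)) = fun D => ∑ k, Z (D k) := by
    funext D; simp
  rw [hsum, ProbabilityTheory.variance_eq_sub hS, hmean, hvarZ] at hvar
  simp only [Finset.sum_const, Finset.card_univ, Fintype.card_fin, nsmul_eq_mul, ne_eq,
    OfNat.ofNat_ne_zero, not_false_eq_true, zero_pow, sub_zero] at hvar
  -- Nonnegativity of the variance of `|S|` is the inequality `(E|S|)² ≤ E[S²]`.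
  have habs := ProbabilityTheory.variance_nonneg (fun D : Fin n → Ω => |∑ k, Z (D k)|) μ
  have hSabs : MemLp (fun D : Fin n → Ω => |∑ k, Z (D k)|) 2 μ := hS.abs
  rw [ProbabilityTheory.variance_eq_sub hSabs] at habs
  apply Real.le_sqrt_of_sq_le
  have h3 : ∫ D : Fin n → Ω, ((fun D : Fin n → Ω => |∑ k, Z (D k)|) ^ 2) D ∂μ =
      ∫ D : Fin n → Ω, ((fun D : Fin n → Ω => ∑ k, Z (D k)) ^ 2) D ∂μ := by
    simp
  rw [h3, hvar] at habs
  have : (n : ℝ) * ∫ ω, Z ω ^ 2 ∂P ≤ n * v := by gcongr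
  linarith

/-- Lower tail of the number of sample points with a given property. -/
theorem measureReal_count_lt_half_le {S : Type*} [Finite S] {W : Ω → S}
    (hW : ∀ s, MeasurableSet (W ⁻¹' {s})) (Q : S → Prop) [DecidablePred Q] :
    (Measure.pi fun _ : Fin n => P).real
      {D | ∑ k, (if Q (W (D k)) then (1 : ℝ) else 0) < n * P.real {ω | Q (W ω)} / 2} ≤
      Real.exp (-(3 / 20) * (n * P.real {ω | Q (W ω)})) := by
  set q := P.real {ω | Q (W ω)}
  set μ : Measure (Fin n → Ω) := Measure.pi fun _ => P
  have := Fintype.ofFinite S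
  have hQ : MeasurableSet {ω | Q (W ω)} := measurableSet_finiteValued hW Q
  have hF : ∀ F : (Fin n → S) → ℝ, Integrable (fun D : Fin n → Ω => F fun k => W (D k)) μ :=
    integrable_sample P hW
  have hmeas : MeasurableSet {D : Fin n → Ω |
      ∑ k, (if Q (W (D k)) then (1 : ℝ) else 0) < n * q / 2} :=
    measurableSet_finiteValued (measurableSet_sample hW)
      fun s => ∑ k, (if Q (s k) then (1 : ℝ) else 0) < n * q / 2
  rw [measureReal_eq_integral hmeas]
  -- Chernoff bound with base `1/2`: the expectation of `(1/2) ^ count` is `(1 - q / 2) ^ n`, and on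
  -- the tail event this power exceeds `2 ^ (-(n * q / 2))`.
  have hone : ∫ ω, (if Q (W ω) then (1 / 2 : ℝ) else 1) ∂P = 1 - q / 2 := by
    have h1 : (fun ω => if Q (W ω) then (1 / 2 : ℝ) else 1) =
        fun ω => 1 - 1 / 2 * (if Q (W ω) then 1 else 0) := by
      funext ω; split_ifs <;> norm_num
    rw [h1, integral_sub (integrable_const _)
      ((integrable_finiteValued P hW fun s => if Q s then (1 : ℝ) else 0).const_mul _),
      integral_const_mul, ← measureReal_eq_integral hQ]
    simp; ring
  have hprod : ∫ D : Fin n → Ω, ∏ k, (if Q (W (D k)) then (1 / 2 : ℝ) else 1) ∂μ =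
      (1 - q / 2) ^ n := by
    rw [integral_fintype_prod_eq_pow fun ω => if Q (W ω) then (1 / 2 : ℝ) else 1, hone]
    simp
  have hq1 : q ≤ 1 := measureReal_le_one
  calc ∫ D : Fin n → Ω,
        (if ∑ k, (if Q (W (D k)) then (1 : ℝ) else 0) < n * q / 2 then (1 : ℝ) else 0) ∂μ
      ≤ ∫ D : Fin n → Ω, Real.exp (Real.log 2 * (n * q / 2)) *
          ∏ k, (if Q (W (D k)) then (1 / 2 : ℝ) else 1) ∂μ := by
        refine integral_mono
          (hF fun s => if ∑ k, (if Q (s k) then (1 : ℝ) else 0) < n * q / 2 then (1 : ℝ) else 0)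
          (hF fun s => Real.exp (Real.log 2 * (n * q / 2)) *
            ∏ k, (if Q (s k) then (1 / 2 : ℝ) else 1)) fun D => ?_
        have hp : ∏ k, (if Q (W (D k)) then (1 / 2 : ℝ) else 1) =
            Real.exp (-(Real.log 2 * ∑ k, (if Q (W (D k)) then (1 : ℝ) else 0))) := by
          rw [Finset.mul_sum, ← Finset.sum_neg_distrib, Real.exp_sum]
          refine Finset.prod_congr rfl fun k _ => ?_
          split_ifs
          · rw [mul_one, Real.exp_neg, Real.exp_log two_pos]; norm_num
          · simp
        dsimp only
        rw [hp, ← Real.exp_add]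
        split_ifs with h
        · apply Real.one_le_exp
          nlinarith [Real.log_pos one_lt_two]
        · positivity
    _ = Real.exp (Real.log 2 * (n * q / 2)) * (1 - q / 2) ^ n := by
        rw [integral_const_mul, hprod]
    _ ≤ Real.exp (Real.log 2 * (n * q / 2)) * Real.exp (-(q / 2)) ^ n := by
        gcongr
        · linarith
        · linarith [Real.add_one_le_exp (-(q / 2))]
    _ ≤ _ := by
        rw [← Real.exp_nat_mul, ← Real.exp_add]
        apply Real.exp_le_exp.2
        have : 0 ≤ (n : ℝ) * q := mul_nonneg (by positivity) measureReal_nonneg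
        -- The exponent is `(log 2 - 1) / 2 * (n * q)`, and `(1 - log 2) / 2 > 3 / 20`.
        nlinarith [Real.log_two_lt_d9]

/-- Two powers of `x` are needed: one compensates the factor `n` by which the estimated posterior
can be wrong on the rare event. -/
theorem exp_tail_le_inv_sq {x : ℝ} (hx : 0 < x) :
    Real.exp (-(3 / 20) * x) ≤ 400 / 9 / x ^ 2 := by
  have h := Real.quadratic_le_exp_of_nonneg (show 0 ≤ 3 / 40 * x by positivity)
  have h2 : 3 / 20 * x ≤ Real.exp (3 / 40 * x) := by nlinarith [sq_nonneg (3 / 40 * x - 1)]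
  have h3 : (3 / 20 * x) ^ 2 ≤ Real.exp (3 / 20 * x) := by
    calc (3 / 20 * x) ^ 2 ≤ Real.exp (3 / 40 * x) ^ 2 := by gcongr
      _ = _ := by rw [← Real.exp_nat_mul]; congr 1; push_cast; ring
  rw [neg_mul, Real.exp_neg, inv_eq_one_div, div_le_div_iff₀ (Real.exp_pos _) (by positivity)]
  nlinarith

theorem exp_tail_le_inv_sqrt {x : ℝ} (hx : 0 < x) :
    Real.exp (-(3 / 20) * x) ≤ 13 / 10 / Real.sqrt x := by
  rw [le_div_iff₀ (Real.sqrt_pos.2 hx)]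
  apply (sq_le_sq₀ (by positivity) (by norm_num)).1
  rw [mul_pow, Real.sq_sqrt hx.le, ← Real.exp_nat_mul]
  have h := Real.quadratic_le_exp_of_nonneg (show 0 ≤ 3 / 10 * x by positivity)
  have h2 : 2 * (3 / 10 * x) ≤ Real.exp (3 / 10 * x) := by nlinarith [sq_nonneg (3 / 10 * x - 1)]
  have h3 : Real.exp ((2 : ℕ) * (-(3 / 20) * x)) * Real.exp (3 / 10 * x) = 1 := by
    rw [← Real.exp_add]; simp; ring
  nlinarith [Real.exp_pos ((2 : ℕ) * (-(3 / 20) * x))]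

theorem integral_abs_empPatternProb_sub_le {m : ℕ} {V : Fin m → Ω → SignType}
    (hV : ∀ j s, MeasurableSet (V j ⁻¹' {s})) (hn : 1 ≤ n) (s : Fin m → SignType) :
    ∫ D : Fin n → Ω, |empPatternProb V D s - patternProb P V s| ∂(Measure.pi fun _ => P) ≤
      1 / (2 * Real.sqrt n) := by
  have hpat := measurableSet_pattern hV
  set q := patternProb P V s with hq
  have hn0 : (0 : ℝ) < n := by exact_mod_cast hn
  have hind : ∫ ω, (if pattern V ω = s then (1 : ℝ) else 0) ∂P = q := by
    exact (measureReal_eq_integral (Q := fun ω => pattern V ω = s) (hpat s)).symm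
  have hint : ∀ F : (Fin m → SignType) → ℝ, Integrable (fun ω => F (pattern V ω)) P :=
    integrable_finiteValued P hpat
  have hmem : MemLp (fun ω => (if pattern V ω = s then (1 : ℝ) else 0) - q) 2 P := by
    rw [memLp_two_iff_integrable_sq]
    · exact hint fun u => ((if u = s then (1 : ℝ) else 0) - q) ^ 2
    · exact (hint fun u => (if u = s then (1 : ℝ) else 0) - q).aestronglyMeasurable
  have h := integral_abs_sum_sample_le (n := n) hmem
    (by rw [integral_sub (hint fun u => if u = s then (1 : ℝ) else 0) (integrable_const _), hind]
        simp)
    (v := 1 / 4) (by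
      have he : ∀ ω, ((if pattern V ω = s then (1 : ℝ) else 0) - q) ^ 2 =
          (1 - 2 * q) * (if pattern V ω = s then (1 : ℝ) else 0) + q ^ 2 := by
        intro ω; split_ifs <;> ring
      simp only [he]
      rw [integral_add ((hint fun u => if u = s then (1 : ℝ) else 0).const_mul _)
        (integrable_const _), integral_const_mul, hind]
      simp
      nlinarith [sq_nonneg (q - 1 / 2)])
  have he : ∀ D : Fin n → Ω, |empPatternProb V D s - q| =
      1 / n * |∑ k, ((if pattern V (D k) = s then (1 : ℝ) else 0) - q)| := by
    intro D
    rw [empPatternProb, Finset.sum_sub_distrib]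
    simp only [Finset.sum_const, Finset.card_univ, Fintype.card_fin, nsmul_eq_mul]
    have hn1 : |1 / (n : ℝ)| = 1 / n := abs_of_pos (by positivity)
    rw [← hn1, ← abs_mul]
    congr 1
    field_simp
  simp only [he]
  rw [integral_const_mul]
  calc 1 / (n : ℝ) * _ ≤ 1 / n * Real.sqrt (n * (1 / 4)) := by gcongr
    _ = 1 / (2 * Real.sqrt n) := by
      rw [Real.sqrt_mul hn0.le, show (1 / 4 : ℝ) = (1 / 2) ^ 2 by norm_num,
        Real.sqrt_sq (by norm_num)]
      have := Real.sq_sqrt hn0.le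
      have := Real.sqrt_pos.2 hn0
      field_simp
      linarith

theorem abs_signType_mul_le (s t : SignType) :
    |((s : SignType) : ℝ) * ((t : SignType) : ℝ)| ≤ if s ≠ 0 ∧ t ≠ 0 then 1 else 0 := by
  cases s <;> cases t <;> simp

theorem abs_empMoment_le {Ω : Type*} {m : ℕ} (V : Fin m → Ω → SignType) (D : Fin n → Ω) (i j : Fin m) :
    |empMoment V D i j| ≤ 1 := by
  rw [empMoment, abs_div]
  apply div_le_one_of_le₀ _ (abs_nonneg _)
  refine le_trans (Finset.abs_sum_le_sum_abs _ _) (le_trans ?_ (le_abs_self _))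
  exact Finset.sum_le_sum fun k _ => abs_signType_mul_le _ _

/-- For a ratio estimator, numerator minus `M` times denominator is a centred sum of terms `Z`. If
the number of joint votes is at least half its mean, the error is at most `2 / (n * o)` times that
sum; otherwise it is at most `2`, on an exponentially rare event. The constant is `2 + 2 * 13 / 10 =
23 / 5`. -/
theorem integral_abs_empMoment_sub_le {Y : Ω → ℤˣ} {m : ℕ} {V : Fin m → Ω → SignType}
    {a c : Fin m → ℝ} (h : HasFactorLaw P Y V a c)
    (hY : ∀ y, MeasurableSet (Y ⁻¹' {y})) (hV : ∀ j s, MeasurableSet (V j ⁻¹' {s}))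
    (hn : 1 ≤ n) {i j : Fin m} (hij : i ≠ j) :
    ∫ D : Fin n → Ω, |empMoment V D i j - moment P (V i) (V j)| ∂(Measure.pi fun _ => P) ≤
      23 / 5 / Real.sqrt (n * overlap P V i j) := by
  have hpat := measurableSet_pattern hV
  set M := moment P (V i) (V j) with hM
  set o := overlap P V i j with ho
  have hoc := h.overlap_eq hY hV hij
  have ho0 : 0 < o := by
    rw [ho, hoc]; exact mul_pos (h.1 i).2.2.1 (h.1 j).2.2.1
  have hn0 : (0 : ℝ) < n := by exact_mod_cast hn
  have hno : 0 < n * o := by positivity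
  have hM1 : |M| ≤ 1 := by
    rw [hM, h.moment_eq hY hV hij, abs_mul]
    have h1 := h.1 i
    have h2 := h.1 j
    apply mul_le_one₀ _ (abs_nonneg _) _ <;> rw [abs_le] <;> constructor <;> linarith
  have hmulM : ∫ ω, ((V i ω : SignType) : ℝ) * ((V j ω : SignType) : ℝ) ∂P = o * M := by
    rw [h.integral_mul_eq hY hV hij, ho, hoc, hM, h.moment_eq hY hV hij]
  have hQm : MeasurableSet {ω | V i ω ≠ 0 ∧ V j ω ≠ 0} :=
    measurableSet_finiteValued hpat fun s => s i ≠ 0 ∧ s j ≠ 0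
  have hbo : ∫ ω, (if V i ω ≠ 0 ∧ V j ω ≠ 0 then (1 : ℝ) else 0) ∂P = o :=
    (measureReal_eq_integral hQm).symm
  have hint : ∀ F : (Fin m → SignType) → ℝ, Integrable (fun ω => F (pattern V ω)) P :=
    integrable_finiteValued P hpat
  have hint1 : Integrable (fun ω => if V i ω ≠ 0 ∧ V j ω ≠ 0 then (1 : ℝ) else 0) P :=
    hint fun s => if s i ≠ 0 ∧ s j ≠ 0 then (1 : ℝ) else 0
  have hint2 : Integrable (fun ω => ((V i ω : SignType) : ℝ) * ((V j ω : SignType) : ℝ)) P :=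
    hint fun s => ((s i : SignType) : ℝ) * ((s j : SignType) : ℝ)
  set Z : Ω → ℝ := fun ω => ((V i ω : SignType) : ℝ) * ((V j ω : SignType) : ℝ) -
    M * if V i ω ≠ 0 ∧ V j ω ≠ 0 then (1 : ℝ) else 0 with hZ
  have hZmem : MemLp Z 2 P := by
    rw [memLp_two_iff_integrable_sq]
    · exact hint fun s => (((s i : SignType) : ℝ) * ((s j : SignType) : ℝ) -
        M * if s i ≠ 0 ∧ s j ≠ 0 then (1 : ℝ) else 0) ^ 2
    · exact (hint2.sub (hint1.const_mul M)).aestronglyMeasurable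
  -- The square of the product of two votes is the indicator that both vote, hence `E[Z²] = o * (1 -
  -- M²) ≤ o`.
  have hZsq : ∀ ω, Z ω ^ 2 = (1 + M ^ 2) * (if V i ω ≠ 0 ∧ V j ω ≠ 0 then (1 : ℝ) else 0) -
      2 * M * (((V i ω : SignType) : ℝ) * ((V j ω : SignType) : ℝ)) := by
    intro ω
    simp only [hZ]
    generalize V i ω = s
    generalize V j ω = t
    cases s <;> cases t <;> simp <;> ring
  have hsum := integral_abs_sum_sample_le (n := n) hZmem
    (by simp only [hZ]
        rw [integral_sub hint2 (hint1.const_mul M), integral_const_mul, hmulM, hbo]; ring)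
    (v := o) (by
      simp only [hZsq]
      rw [integral_sub (hint1.const_mul _) (hint2.const_mul _), integral_const_mul,
        integral_const_mul, hmulM, hbo]
      nlinarith [sq_nonneg M])
  have htail := measureReal_count_lt_half_le (P := P) (n := n) hpat
    fun s => s i ≠ 0 ∧ s j ≠ 0
  rw [show P.real {ω | pattern V ω i ≠ 0 ∧ pattern V ω j ≠ 0} = o from rfl] at htail
  set N : (Fin n → Ω) → ℝ := fun D => ∑ k, if V i (D k) ≠ 0 ∧ V j (D k) ≠ 0 then (1 : ℝ) else 0
  have hbad : MeasurableSet {D : Fin n → Ω | N D < n * o / 2} :=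
    measurableSet_finiteValued (measurableSet_sample hpat) fun s : Fin n → Fin m → SignType =>
      ∑ k, (if s k i ≠ 0 ∧ s k j ≠ 0 then (1 : ℝ) else 0) < n * o / 2
  have hpt : ∀ D : Fin n → Ω, |empMoment V D i j - M| ≤
      2 / (n * o) * |∑ k, Z (D k)| + 2 * if N D < n * o / 2 then 1 else 0 := by
    intro D
    split_ifs with hN
    · have h1 : |empMoment V D i j - M| ≤ 2 := by
        refine le_trans (abs_sub _ _) ?_
        linarith [abs_empMoment_le V D i j]
      have : 0 ≤ 2 / (n * o) * |∑ k, Z (D k)| := by positivity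
      linarith
    · push Not at hN
      have hN0 : 0 < N D := lt_of_lt_of_le (by positivity) hN
      have he : empMoment V D i j - M = (∑ k, Z (D k)) / N D := by
        rw [eq_div_iff hN0.ne', sub_mul]
        simp only [hZ]
        rw [Finset.sum_sub_distrib, ← Finset.mul_sum, empMoment]
        rw [div_mul_cancel₀ _ hN0.ne']
      rw [he, abs_div, abs_of_pos hN0, mul_zero, add_zero, div_mul_eq_mul_div,
        div_le_div_iff₀ hN0 hno]
      nlinarith [abs_nonneg (∑ k, Z (D k))]
  have hi1 : Integrable (fun D : Fin n → Ω => |empMoment V D i j - M|)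
      (Measure.pi fun _ => P) :=
    integrable_sample P hpat fun s => |(∑ k, ((s k i : SignType) : ℝ) * ((s k j : SignType) : ℝ)) /
      (∑ k, if s k i ≠ 0 ∧ s k j ≠ 0 then (1 : ℝ) else 0) - M|
  have hi2 : Integrable (fun D : Fin n → Ω => |∑ k, Z (D k)|) (Measure.pi fun _ => P) :=
    integrable_sample P hpat fun s => |∑ k, (((s k i : SignType) : ℝ) * ((s k j : SignType) : ℝ) -
      M * if s k i ≠ 0 ∧ s k j ≠ 0 then (1 : ℝ) else 0)|
  have hi3 : Integrable (fun D : Fin n → Ω => if N D < n * o / 2 then (1 : ℝ) else 0)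
      (Measure.pi fun _ => P) :=
    integrable_sample P hpat fun s =>
      if ∑ k, (if s k i ≠ 0 ∧ s k j ≠ 0 then (1 : ℝ) else 0) < n * o / 2 then (1 : ℝ) else 0
  refine le_trans (integral_mono hi1 ((hi2.const_mul _).add (hi3.const_mul _)) hpt) ?_
  simp only [Pi.add_apply]
  rw [integral_add (hi2.const_mul _) (hi3.const_mul _), integral_const_mul, integral_const_mul,
    ← measureReal_eq_integral hbad]
  have h1 : 2 / (n * o) * ∫ D : Fin n → Ω, |∑ k, Z (D k)| ∂(Measure.pi fun _ => P) ≤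
      2 / Real.sqrt (n * o) := by
    calc _ ≤ 2 / (n * o) * Real.sqrt (n * o) := by gcongr
      _ = 2 / Real.sqrt (n * o) := by
        have := Real.sqrt_pos.2 hno
        rw [div_mul_eq_mul_div, div_eq_div_iff hno.ne' this.ne', mul_assoc,
          Real.mul_self_sqrt hno.le]
  have h2 := htail.trans (exp_tail_le_inv_sqrt hno)
  calc _ ≤ 2 / Real.sqrt (n * o) + 2 * (13 / 10 / Real.sqrt (n * o)) :=
        add_le_add h1 (mul_le_mul_of_nonneg_left h2 (by norm_num))
    _ = _ := by ring

end Sample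

/-! ### Stability of the triplet formula and of products of vote factors. -/

section Deterministic

theorem abs_min_one_sub_le {x a : ℝ} (ha : a ≤ 1) : |min 1 x - a| ≤ |x - a| := by
  rcases le_total 1 x with h | h
  · rw [min_eq_left h, abs_of_nonneg (by linarith), abs_of_nonneg (by linarith)]; linarith
  · rw [min_eq_right h]

/-- Stability of the triplet formula `E = √(X Y / Z)` for `X = E F`, `Y = E G`, `Z = F G`. -/
theorem abs_triplet_sub_le {x y z E F G e c : ℝ} (hy : |y| ≤ 1) (he : 0 < e) (heE : e ≤ E)
    (hE : E ≤ 1) (hF : |F| ≤ 1) (hc : 0 < c) (hcZ : c ≤ F * G) :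
    |min 1 (1 / 2 * (Real.sqrt |x * y / z| + 1)) - (1 + E) / 2| ≤
      1 / (c * e) * (|x - E * F| + |y - E * G| + |z - F * G|) := by
  have hE0 : 0 < E := he.trans_le heE
  have h1 := abs_nonneg (x - E * F)
  have h2 := abs_nonneg (y - E * G)
  have h3 := abs_nonneg (z - F * G)
  rw [one_div_mul_eq_div (c * e), le_div_iff₀ (by positivity)]
  -- If `z` is small, it is already off by `c / 2`, while the truncated estimate and the truth both
  -- lie in `[1/2, 1]`. Otherwise division by `z` is safe.
  rcases lt_or_ge z (c / 2) with hz | hz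
  · have hd : c / 2 ≤ |z - F * G| := by
      rw [abs_sub_comm]; exact le_trans (by linarith) (le_abs_self _)
    have hl : |min 1 (1 / 2 * (Real.sqrt |x * y / z| + 1)) - (1 + E) / 2| ≤ 1 / 2 := by
      have hs := Real.sqrt_nonneg |x * y / z|
      have h5 : 1 / 2 ≤ min 1 (1 / 2 * (Real.sqrt |x * y / z| + 1)) :=
        le_min (by norm_num) (by linarith)
      have h6 := min_le_left 1 (1 / 2 * (Real.sqrt |x * y / z| + 1))
      rw [abs_le]; constructor <;> linarith
    have hce : c * e ≤ c := by nlinarith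
    calc _ ≤ 1 / 2 * (c * e) := by gcongr
      _ ≤ _ := by linarith
  · have hz0 : 0 < z := lt_of_lt_of_le (by positivity) hz
    set w := |x * y / z| with hw
    -- The error is measured against `E ^ 2 * z`, which equals `x * y` at the true moments; the
    -- difference telescopes into one term per moment with coefficients at most `1`.
    have hnum : |x * y - E ^ 2 * z| ≤ |x - E * F| + |y - E * G| + |z - F * G| := by
      have : x * y - E ^ 2 * z =
          (x - E * F) * y + E * F * (y - E * G) + -(E ^ 2 * (z - F * G)) := by ring
      rw [this]
      refine (abs_add_three _ _ _).trans ?_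
      rw [abs_neg, abs_mul, abs_mul, abs_mul (E ^ 2), abs_mul E F, abs_of_pos hE0,
        abs_of_pos (pow_pos hE0 2)]
      have hEF : E * |F| ≤ 1 := mul_le_one₀ hE (abs_nonneg _) hF
      have hE2 : E ^ 2 ≤ 1 := pow_le_one₀ hE0.le hE
      have := mul_le_mul_of_nonneg_left hy h1
      have := mul_le_mul_of_nonneg_right hEF h2
      have := mul_le_mul_of_nonneg_right hE2 h3
      linarith
    have hwE : |w - E ^ 2| ≤ (|x - E * F| + |y - E * G| + |z - F * G|) * (2 / c) := by
      calc |w - E ^ 2| = abs (|x * y / z| - |E ^ 2|) := by rw [abs_of_pos (pow_pos hE0 2)]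
        _ ≤ |x * y / z - E ^ 2| := abs_abs_sub_abs_le_abs_sub _ _
        _ = |x * y - E ^ 2 * z| / z := by
          rw [← abs_of_pos hz0, ← abs_div, abs_of_pos hz0]; congr 1; field_simp
        _ ≤ (|x - E * F| + |y - E * G| + |z - F * G|) / (c / 2) := by gcongr
        _ = _ := by field_simp
    have hs := Real.sqrt_nonneg w
    have hfac : |Real.sqrt w - E| * (Real.sqrt w + E) = |w - E ^ 2| := by
      have hp : |Real.sqrt w + E| = Real.sqrt w + E := abs_of_pos (by linarith)
      rw [← hp, ← abs_mul]
      congr 1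
      have := Real.sq_sqrt (abs_nonneg (x * y / z))
      rw [← hw] at this
      linear_combination this
    -- The lower bound `e ≤ E` keeps the square root away from its singularity at `0`.
    have hse : |Real.sqrt w - E| * e ≤ |w - E ^ 2| := by
      rw [← hfac]; gcongr; linarith
    calc _ ≤ |1 / 2 * (Real.sqrt w + 1) - (1 + E) / 2| * (c * e) := by
          exact mul_le_mul_of_nonneg_right (abs_min_one_sub_le (by linarith)) (by positivity)
      _ = 1 / 2 * c * (|Real.sqrt w - E| * e) := by
          rw [show 1 / 2 * (Real.sqrt w + 1) - (1 + E) / 2 = 1 / 2 * (Real.sqrt w - E) by ring,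
            abs_mul, abs_of_pos (by norm_num : (0 : ℝ) < 1 / 2)]; ring
      _ ≤ 1 / 2 * c * ((|x - E * F| + |y - E * G| + |z - F * G|) * (2 / c)) := by
          exact mul_le_mul_of_nonneg_left (hse.trans hwE) (by positivity)
      _ = _ := by field_simp

/-- Upper bound of `voteFactor` that does not involve the accuracy. -/
def voteBound (c : ℝ) (s : SignType) : ℝ := if s = 0 then 1 - c else c

theorem voteFactor_nonneg {a c : ℝ} (ha : a ∈ Set.Icc (0 : ℝ) 1) (hc : c ∈ Set.Icc (0 : ℝ) 1)
    (s : SignType) : 0 ≤ voteFactor a c s := by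
  obtain ⟨h1, h2⟩ := ha
  obtain ⟨h3, h4⟩ := hc
  have : 0 ≤ 1 - a := by linarith
  have : 0 ≤ 1 - c := by linarith
  unfold voteFactor
  split_ifs <;> positivity

theorem voteFactor_le {a c : ℝ} (ha : a ∈ Set.Icc (0 : ℝ) 1) (hc : c ∈ Set.Icc (0 : ℝ) 1)
    (s : SignType) : voteFactor a c s ≤ voteBound c s := by
  obtain ⟨h1, h2⟩ := ha
  obtain ⟨h3, h4⟩ := hc
  cases s <;> simp [voteFactor, voteBound] <;> nlinarith

theorem abs_voteFactor_sub_le {a a' c : ℝ} (hc : c ∈ Set.Icc (0 : ℝ) 1) (s : SignType) :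
    |voteFactor a c s - voteFactor a' c s| ≤ voteBound c s * |a - a'| := by
  obtain ⟨h3, h4⟩ := hc
  have h : 0 ≤ (1 - c) * |a - a'| := mul_nonneg (by linarith) (abs_nonneg _)
  cases s
  · simpa [voteFactor, voteBound] using h
  · have : (1 - a) * c - (1 - a') * c = -(c * (a - a')) := by ring
    simp [voteFactor, voteBound, this, abs_mul, abs_of_nonneg h3]
  · simp [voteFactor, voteBound, ← sub_mul, abs_mul, abs_of_nonneg h3, mul_comm]

/-- Telescoping one factor at a time. Keeping the common bounds `w` instead of replacing them by `1`
lets the later sum over patterns cost `2 ^ m` and not `3 ^ m`. -/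
theorem abs_prod_sub_prod_le {ι : Type*} (T : Finset ι) (f g w d : ι → ℝ)
    (hf : ∀ i, 0 ≤ f i) (hfw : ∀ i, f i ≤ w i) (hg : ∀ i, 0 ≤ g i) (hgw : ∀ i, g i ≤ w i)
    (hd : ∀ i, |f i - g i| ≤ w i * d i) :
    |∏ i ∈ T, f i - ∏ i ∈ T, g i| ≤ (∏ i ∈ T, w i) * ∑ i ∈ T, d i := by
  classical
  induction T using Finset.induction_on with
  | empty => simp
  | insert i T hi ih =>
    rw [Finset.prod_insert hi, Finset.prod_insert hi, Finset.prod_insert hi, Finset.sum_insert hi]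
    have hw : ∀ i, 0 ≤ w i := fun i => (hf i).trans (hfw i)
    have hG : 0 ≤ ∏ i ∈ T, g i := Finset.prod_nonneg fun i _ => hg i
    have hGW : ∏ i ∈ T, g i ≤ ∏ i ∈ T, w i := Finset.prod_le_prod (fun i _ => hg i) fun i _ => hgw i
    have hW : 0 ≤ ∏ i ∈ T, w i := hG.trans hGW
    calc |f i * ∏ i ∈ T, f i - g i * ∏ i ∈ T, g i|
        = |f i * (∏ i ∈ T, f i - ∏ i ∈ T, g i) + (f i - g i) * ∏ i ∈ T, g i| := by ring_nf
      _ ≤ f i * |∏ i ∈ T, f i - ∏ i ∈ T, g i| + |f i - g i| * ∏ i ∈ T, g i := by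
        refine (abs_add_le _ _).trans_eq ?_
        rw [abs_mul, abs_mul, abs_of_nonneg (hf i), abs_of_nonneg hG]
      _ ≤ w i * ((∏ i ∈ T, w i) * ∑ i ∈ T, d i) + w i * d i * ∏ i ∈ T, w i := by
        have h0 : 0 ≤ w i * d i := (abs_nonneg _).trans (hd i)
        have := hw i
        exact add_le_add (mul_le_mul (hfw i) ih (abs_nonneg _) this)
          (mul_le_mul (hd i) hGW hG h0)
      _ = _ := by ring

/-- For one source the three bounds add up to `1 + c ≤ 2`. -/
theorem sum_prod_voteBound_le {m : ℕ} (c : Fin m → ℝ) (hc : ∀ i, c i ∈ Set.Icc (0 : ℝ) 1) :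
    ∑ s : Fin m → SignType, ∏ i, voteBound (c i) (s i) ≤ 2 ^ m := by
  rw [← Fintype.prod_sum fun i t => voteBound (c i) t]
  calc ∏ i, ∑ t, voteBound (c i) t ≤ ∏ _i : Fin m, (2 : ℝ) := by
        refine Finset.prod_le_prod (fun i _ => ?_) fun i _ => ?_ <;>
          · have := (hc i).1
            have := (hc i).2
            simp [sum_signType, voteBound]
            linarith
    _ = 2 ^ m := by simp

theorem voteBound_mem {c : ℝ} (hc : c ∈ Set.Icc (0 : ℝ) 1) (s : SignType) :
    voteBound c s ∈ Set.Icc (0 : ℝ) 1 := by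
  obtain ⟨h3, h4⟩ := hc
  unfold voteBound
  split_ifs <;> constructor <;> linarith

end Deterministic

/-! ### The expected estimation error. -/

section Estimation

variable {Ω : Type*} [MeasurableSpace Ω] {P : Measure Ω} [IsProbabilityMeasure P]
  {Y : Ω → ℤˣ} {m : ℕ} {V : Fin m → Ω → SignType} {a c : Fin m → ℝ} {n : ℕ}

theorem sum_patternProb (hV : ∀ j s, MeasurableSet (V j ⁻¹' {s})) :
    ∑ s, patternProb P V s = 1 := by
  have := integral_finiteValued P (measurableSet_pattern hV) fun _ => 1
  simpa [patternProb] using this.symm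

theorem abs_risk_sub_risk_le (hY : ∀ y, MeasurableSet (Y ⁻¹' {y}))
    (hV : ∀ j s, MeasurableSet (V j ⁻¹' {s})) (p p' : (Fin m → SignType) → ℝ) :
    |risk P Y (fun ω => 2 * p (pattern V ω) - 1) - risk P Y (fun ω => 2 * p' (pattern V ω) - 1)| ≤
      ∑ s, patternProb P V s * |p' s - p s| := by
  have hpat := measurableSet_pattern hV
  have hW := measurableSet_preimage_prodMk hY hpat
  have hint : ∀ p : (Fin m → SignType) → ℝ,
      Integrable (fun ω => 1 / 2 * |((Y ω : ℤ) : ℝ) - (2 * p (pattern V ω) - 1)|) P := fun p =>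
    integrable_finiteValued P hW fun w => 1 / 2 * |((w.1 : ℤ) : ℝ) - (2 * p w.2 - 1)|
  have hsum : ∑ s, patternProb P V s * |p' s - p s| =
      ∫ ω, |p' (pattern V ω) - p (pattern V ω)| ∂P :=
    (integral_finiteValued P hpat fun s => |p' s - p s|).symm
  rw [risk, risk, ← integral_sub (hint p) (hint p'), hsum]
  refine (abs_integral_le_integral_abs).trans (integral_mono ((hint p).sub (hint p')).abs
    (integrable_finiteValued P hpat fun s => |p' s - p s|) fun ω => ?_)
  dsimp only
  rw [← mul_sub, abs_mul, abs_of_pos (by norm_num : (0 : ℝ) < 1 / 2)]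
  have h := abs_abs_sub_abs_le_abs_sub (((Y ω : ℤ) : ℝ) - (2 * p (pattern V ω) - 1))
    (((Y ω : ℤ) : ℝ) - (2 * p' (pattern V ω) - 1))
  have h2 : ((Y ω : ℤ) : ℝ) - (2 * p (pattern V ω) - 1) -
      (((Y ω : ℤ) : ℝ) - (2 * p' (pattern V ω) - 1)) =
      2 * (p' (pattern V ω) - p (pattern V ω)) := by ring
  rw [h2, abs_mul, abs_two] at h
  linarith

/-- The `2 ^ m` patterns without any abstention lie in every overlap, and each has probability at
least `c_p`. -/
theorem HasFactorLaw.two_pow_mul_minPatternProb_le (h : HasFactorLaw P Y V a c)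
    (hY : ∀ y, MeasurableSet (Y ⁻¹' {y})) (hV : ∀ j s, MeasurableSet (V j ⁻¹' {s}))
    (j k : Fin m) : 2 ^ m * minPatternProb P V ≤ overlap P V j k := by
  have hpat := measurableSet_pattern hV
  rw [overlap, show {ω | V j ω ≠ 0 ∧ V k ω ≠ 0} = {ω | pattern V ω j ≠ 0 ∧ pattern V ω k ≠ 0}
    from rfl, measureReal_finiteValued P hpat fun s => s j ≠ 0 ∧ s k ≠ 0, ← Finset.sum_filter]
  set T : Finset (Fin m → SignType) := Fintype.piFinset fun _ => {1, -1}
  have hT : T.card = 2 ^ m := by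
    rw [Fintype.card_piFinset]; simp [show ({1, -1} : Finset SignType).card = 2 from rfl]
  have hsub : T ⊆ Finset.univ.filter fun s => s j ≠ 0 ∧ s k ≠ 0 := by
    intro s hs
    have hs' : ∀ i, s i ≠ 0 := by
      intro i hi
      have := Fintype.mem_piFinset.1 hs i
      rw [hi] at this
      revert this; decide
    simp [hs']
  calc (2 : ℝ) ^ m * minPatternProb P V = ∑ s ∈ T, minPatternProb P V := by simp [hT]
    _ ≤ ∑ s ∈ T, patternProb P V s :=
      Finset.sum_le_sum fun s _ => minPatternProb_le s (h.patternProb_pos hY hV s)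
    _ ≤ _ := Finset.sum_le_sum_of_subset_of_nonneg hsub fun _ _ _ => measureReal_nonneg

theorem HasFactorLaw.card_mul_minPatternProb_le (h : HasFactorLaw P Y V a c)
    (hY : ∀ y, MeasurableSet (Y ⁻¹' {y})) (hV : ∀ j s, MeasurableSet (V j ⁻¹' {s})) :
    (Fintype.card (Fin m → SignType) : ℝ) * minPatternProb P V ≤ 1 := by
  rw [← sum_patternProb hV (P := P)]
  calc _ = ∑ _s : Fin m → SignType, minPatternProb P V := by simp
    _ ≤ _ := Finset.sum_le_sum fun s _ => minPatternProb_le s (h.patternProb_pos hY hV s)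

theorem estAccuracy_mem {Ω : Type*} (V : Fin m → Ω → SignType) (t : Fin m → Fin m × Fin m) (D : Fin n → Ω)
    (i : Fin m) : estAccuracy V t D i ∈ Set.Icc (0 : ℝ) 1 :=
  ⟨le_min zero_le_one (by positivity), min_le_left _ _⟩

theorem HasFactorLaw.abs_estAccuracy_sub_le (h : HasFactorLaw P Y V a c)
    (hY : ∀ y, MeasurableSet (Y ⁻¹' {y})) (hV : ∀ j s, MeasurableSet (V j ⁻¹' {s}))
    {t : Fin m → Fin m × Fin m}
    (ht : ∀ i, (t i).1 ≠ i ∧ (t i).2 ≠ i ∧ (t i).1 ≠ (t i).2) {e c₁ : ℝ} (he : 0 < e)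
    (hea : ∀ i, e ≤ signedAccuracy P Y (V i)) (hc₁ : 0 < c₁)
    (hcm : ∀ j k, j ≠ k → c₁ ≤ moment P (V j) (V k)) (D : Fin n → Ω) (i : Fin m) :
    |estAccuracy V t D i - a i| ≤ 1 / (c₁ * e) *
      (|empMoment V D i (t i).1 - moment P (V i) (V (t i).1)| +
        |empMoment V D i (t i).2 - moment P (V i) (V (t i).2)| +
        |empMoment V D (t i).1 (t i).2 - moment P (V (t i).1) (V (t i).2)|) := by
  obtain ⟨h1, h2, h3⟩ := ht i
  have hc := hcm _ _ h3
  have hei := hea i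
  rw [h.signedAccuracy_eq hY hV] at hei
  rw [h.moment_eq hY hV h3] at hc
  rw [h.moment_eq hY hV h1.symm, h.moment_eq hY hV h2.symm, h.moment_eq hY hV h3]
  have hi := h.1 i
  have hj := h.1 (t i).1
  have := abs_triplet_sub_le (x := empMoment V D i (t i).1) (z := empMoment V D (t i).1 (t i).2)
    (abs_empMoment_le V D i (t i).2) he hei (by linarith)
    (show |2 * a (t i).1 - 1| ≤ 1 by rw [abs_le]; constructor <;> linarith) hc₁ hc
  rwa [show (1 + (2 * a i - 1)) / 2 = a i by ring] at this

theorem empPatternProb_eq_zero_or_ge {Ω : Type*} (V : Fin m → Ω → SignType) (D : Fin n → Ω)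
    (s : Fin m → SignType) : empPatternProb V D s = 0 ∨ 1 / (n : ℝ) ≤ empPatternProb V D s := by
  by_cases hs : ∃ k, pattern V (D k) = s
  · right
    obtain ⟨k, hk⟩ := hs
    rw [empPatternProb]
    gcongr
    calc (1 : ℝ) = if pattern V (D k) = s then 1 else 0 := by simp [hk]
      _ ≤ _ := Finset.single_le_sum (f := fun k => if pattern V (D k) = s then (1 : ℝ) else 0)
        (fun _ _ => by split_ifs <;> norm_num) (Finset.mem_univ k)
  · left
    push Not at hs
    simp [empPatternProb, hs]

/-- `B` and `B'` are the true and estimated products of vote factors, `q` and `q'` the true and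
empirical pattern probabilities. If `q' ≥ q / 2` the quotient is stable; otherwise the error is at
most the sample size `N`, charged to the indicator. -/
theorem mul_abs_div_sub_div_le {B B' q q' w N : ℝ} (hq : 0 < q) (hB : B / 2 ≤ q) (hB0 : 0 ≤ B)
    (hB' : 0 ≤ B') (hB1 : B' ≤ 1) (hw : |B' - B| ≤ w) (hN : 1 ≤ N) (hq' : q' = 0 ∨ 1 / N ≤ q')  :
    q * |B' * (1 / 2) / q' - B * (1 / 2) / q| ≤
      w + 2 * |q' - q| + q * (N * if q' < q / 2 then 1 else 0) := by
  have hw0 : 0 ≤ w := (abs_nonneg _).trans hw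
  have habs := abs_nonneg (q' - q)
  have hp1 : B * (1 / 2) / q ≤ 1 := by rw [div_le_one hq]; linarith
  have hp0 : 0 ≤ B * (1 / 2) / q := by positivity
  split_ifs with hbad
  · have : |B' * (1 / 2) / q' - B * (1 / 2) / q| ≤ N := by
      -- An unseen pattern has estimated posterior `x / 0 = 0`; a seen one has frequency at least `1
      -- / N`.
      rcases hq' with rfl | hq'
      · rw [div_zero, zero_sub, abs_neg, abs_of_nonneg hp0]; linarith
      · have hN0 : 0 < N := by linarith
        have hq0 : 0 < q' := lt_of_lt_of_le (by positivity) hq'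
        have h1 : B' * (1 / 2) / q' ≤ N := by
          rw [div_le_iff₀ hq0]
          rw [div_le_iff₀ hN0] at hq'
          linarith
        have h0 : 0 ≤ B' * (1 / 2) / q' := by positivity
        rw [abs_le]; constructor <;> linarith
    have := mul_le_mul_of_nonneg_left this hq.le
    linarith
  · push Not at hbad
    have hq0 : 0 < q' := lt_of_lt_of_le (by positivity) hbad
    have he : q * |B' * (1 / 2) / q' - B * (1 / 2) / q| =
        |(B' - B) / 2 - B * (1 / 2) / q * (q' - q)| * (q / q') := by
      rw [show (B' - B) / 2 - B * (1 / 2) / q * (q' - q) =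
        (B' * (1 / 2) / q' - B * (1 / 2) / q) * q' by field_simp; ring, abs_mul, abs_of_pos hq0]
      field_simp
    have h2 : q / q' ≤ 2 := by rw [div_le_iff₀ hq0]; linarith
    have h3 : |(B' - B) / 2 - B * (1 / 2) / q * (q' - q)| ≤ w / 2 + |q' - q| := by
      refine (abs_sub _ _).trans ?_
      rw [abs_mul, abs_of_nonneg hp0, abs_div, abs_two]
      have := mul_le_mul_of_nonneg_right hp1 habs
      linarith
    rw [he]
    calc _ ≤ (w / 2 + |q' - q|) * 2 := by gcongr
      _ ≤ _ := by linarith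

theorem HasFactorLaw.riskGap_le (h : HasFactorLaw P Y V a c)
    (hY : ∀ y, MeasurableSet (Y ⁻¹' {y})) (hV : ∀ j s, MeasurableSet (V j ⁻¹' {s}))
    (hb : P.real {ω | Y ω = 1} = 1 / 2) (t : Fin m → Fin m × Fin m) (hn : 1 ≤ n)
    (D : Fin n → Ω) :
    riskGap P Y V t D ≤ ∑ s, ((∏ i, voteBound (c i) (s i)) * ∑ i, |estAccuracy V t D i - a i| +
      2 * |empPatternProb V D s - patternProb P V s| + patternProb P V s *
        (n * if empPatternProb V D s < patternProb P V s / 2 then 1 else 0)) := by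
  have hn1 : (1 : ℝ) ≤ n := by exact_mod_cast hn
  refine (abs_risk_sub_risk_le hY hV _ _).trans (Finset.sum_le_sum fun s _ => ?_)
  have hc : ∀ i, c i ∈ Set.Icc (0 : ℝ) 1 := fun i => ⟨(h.1 i).2.2.1.le, (h.1 i).2.2.2.le⟩
  have ha : ∀ i, a i ∈ Set.Icc (0 : ℝ) 1 := fun i => ⟨(h.1 i).1.le, (h.1 i).2.1.le⟩
  have hâ := fun i => estAccuracy_mem V t D i
  simp only [labelProb, h.accuracy_eq hY hV, h.coverage_eq hY hV, hb]
  refine mul_abs_div_sub_div_le (h.patternProb_pos hY hV s) ?_ ?_ ?_ ?_ ?_ hn1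
    (empPatternProb_eq_zero_or_ge V D s)
  · rw [h.patternProb_eq hY hV]
    have := Finset.prod_nonneg fun i (_ : i ∈ Finset.univ) =>
      voteFactor_nonneg (ha i) (hc i) (relVote (-1) (s i))
    linarith
  · exact Finset.prod_nonneg fun i _ => voteFactor_nonneg (ha i) (hc i) _
  · exact Finset.prod_nonneg fun i _ => voteFactor_nonneg (hâ i) (hc i) _
  · exact Finset.prod_le_one (fun i _ => voteFactor_nonneg (hâ i) (hc i) _) fun i _ =>
      (voteFactor_le (hâ i) (hc i) _).trans (voteBound_mem (hc i) _).2
  · exact abs_prod_sub_prod_le _ _ _ _ _ (fun i => voteFactor_nonneg (hâ i) (hc i) _)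
      (fun i => voteFactor_le (hâ i) (hc i) _) (fun i => voteFactor_nonneg (ha i) (hc i) _)
      (fun i => voteFactor_le (ha i) (hc i) _) fun i => abs_voteFactor_sub_le (hc i) _

end Estimation

theorem integral_add_three {α : Type*} [MeasurableSpace α] {μ : Measure α} {f g k : α → ℝ}
    (hf : Integrable f μ) (hg : Integrable g μ) (hk : Integrable k μ) :
    ∫ x, (f x + g x + k x) ∂μ = ∫ x, f x ∂μ + ∫ x, g x ∂μ + ∫ x, k x ∂μ := by
  rw [integral_add (f := fun x => f x + g x) (hf.add hg) hk, integral_add hf hg]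

section Estimation

variable {Ω : Type*} [MeasurableSpace Ω] {P : Measure Ω} [IsProbabilityMeasure P]
  {Y : Ω → ℤˣ} {m : ℕ} {V : Fin m → Ω → SignType} {a c : Fin m → ℝ} {n : ℕ}

theorem HasFactorLaw.minPatternProb_pos (h : HasFactorLaw P Y V a c)
    (hY : ∀ y, MeasurableSet (Y ⁻¹' {y})) (hV : ∀ j s, MeasurableSet (V j ⁻¹' {s})) :
    0 < minPatternProb P V := by
  have : Nonempty Ω := nonempty_of_isProbabilityMeasure P
  have hf : (Set.range fun ω => patternProb P V (pattern V ω)).Finite :=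
    (Set.finite_range (patternProb P V)).subset (by rintro _ ⟨ω, rfl⟩; exact ⟨_, rfl⟩)
  obtain ⟨ω, hω⟩ := (Set.range_nonempty fun ω => patternProb P V (pattern V ω)).csInf_mem hf
  rw [minPatternProb, iInf, ← hω]
  exact h.patternProb_pos hY hV _

/-- As `o ≤ 1`, `2 ^ m * c_p ≤ o ≤ √o`, so the factor `2 ^ m / √o` is at most `1 / c_p`. -/
theorem HasFactorLaw.two_pow_div_sqrt_overlap_le (h : HasFactorLaw P Y V a c)
    (hY : ∀ y, MeasurableSet (Y ⁻¹' {y})) (hV : ∀ j s, MeasurableSet (V j ⁻¹' {s}))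
    (hn : 1 ≤ n) (j k : Fin m) :
    2 ^ m * (23 / 5 / Real.sqrt (n * overlap P V j k)) ≤
      23 / 5 / (Real.sqrt n * minPatternProb P V) := by
  have hcp := h.minPatternProb_pos hY hV
  have hn0 : (0 : ℝ) < n := by exact_mod_cast hn
  set o := overlap P V j k
  have ho : 2 ^ m * minPatternProb P V ≤ o := h.two_pow_mul_minPatternProb_le hY hV j k
  have ho0 : 0 < o := lt_of_lt_of_le (by positivity) ho
  have ho1 : o ≤ 1 := measureReal_le_one
  have hos : o ≤ Real.sqrt o := Real.le_sqrt_of_sq_le (by nlinarith)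
  rw [Real.sqrt_mul hn0.le, mul_div_assoc', div_le_div_iff₀ (by positivity) (by positivity)]
  have := mul_le_mul_of_nonneg_left (ho.trans hos) (show 0 ≤ 23 / 5 * Real.sqrt n by positivity)
  linarith

/-- The expected estimation error over all data sets, without conditioning. -/
theorem HasFactorLaw.integral_riskGap_le (h : HasFactorLaw P Y V a c)
    (hY : ∀ y, MeasurableSet (Y ⁻¹' {y})) (hV : ∀ j s, MeasurableSet (V j ⁻¹' {s}))
    (hb : P.real {ω | Y ω = 1} = 1 / 2) {t : Fin m → Fin m × Fin m}
    (ht : ∀ i, (t i).1 ≠ i ∧ (t i).2 ≠ i ∧ (t i).1 ≠ (t i).2) {e c₁ : ℝ} (he : 0 < e)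
    (hea : ∀ i, e ≤ signedAccuracy P Y (V i)) (hc₁ : 0 < c₁)
    (hcm : ∀ j k, j ≠ k → c₁ ≤ moment P (V j) (V k)) (hn : 1 ≤ n) :
    Integrable (fun D : Fin n → Ω => riskGap P Y V t D) (Measure.pi fun _ => P) ∧
    ∫ D : Fin n → Ω, riskGap P Y V t D ∂(Measure.pi fun _ => P) ≤
      69 / 5 * m / (c₁ * e) / (Real.sqrt n * minPatternProb P V) +
      1 / (Real.sqrt n * minPatternProb P V) + 400 / 9 / (n * minPatternProb P V ^ 2) := by
  set μ : Measure (Fin n → Ω) := Measure.pi fun _ => P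
  set cp := minPatternProb P V
  have hcp : 0 < cp := h.minPatternProb_pos hY hV
  have hpat := measurableSet_pattern hV
  have hn0 : (0 : ℝ) < n := by exact_mod_cast hn
  have hc : ∀ i, c i ∈ Set.Icc (0 : ℝ) 1 := fun i => ⟨(h.1 i).2.2.1.le, (h.1 i).2.2.2.le⟩
  -- The estimators are rewritten as functions of the table of sampled votes, which takes finitely
  -- many values; this makes them integrable.
  let mom : (Fin n → Fin m → SignType) → Fin m → Fin m → ℝ := fun s i j =>
    (∑ k, ((s k i : SignType) : ℝ) * ((s k j : SignType) : ℝ)) /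
      (∑ k, if s k i ≠ 0 ∧ s k j ≠ 0 then (1 : ℝ) else 0)
  let acc : (Fin n → Fin m → SignType) → Fin m → ℝ := fun s i =>
    min 1 (1 / 2 * (Real.sqrt |mom s i (t i).1 * mom s i (t i).2 / mom s (t i).1 (t i).2| + 1))
  let emp : (Fin n → Fin m → SignType) → (Fin m → SignType) → ℝ := fun s u =>
    (∑ k, if s k = u then (1 : ℝ) else 0) / n
  have hint : ∀ F : (Fin n → Fin m → SignType) → ℝ,
      Integrable (fun D : Fin n → Ω => F fun k => pattern V (D k)) μ := integrable_sample P hpat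
  have hgap : Integrable (fun D : Fin n → Ω => riskGap P Y V t D) μ :=
    hint fun s => |risk P Y (labelModel P Y V) -
      risk P Y fun ω => 2 * labelProb P Y V (acc s) (emp s) (pattern V ω) - 1|
  have hacc : ∀ i, Integrable (fun D : Fin n → Ω => |estAccuracy V t D i - a i|) μ := fun i =>
    hint fun s => |acc s i - a i|
  have hmom : ∀ i j, Integrable
      (fun D : Fin n → Ω => |empMoment V D i j - moment P (V i) (V j)|) μ := fun i j =>
    hint fun s => |mom s i j - moment P (V i) (V j)|
  have hemp : ∀ u, Integrable (fun D : Fin n → Ω => |empPatternProb V D u - patternProb P V u|) μ :=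
    fun u => hint fun s => |emp s u - patternProb P V u|
  have hbad : ∀ u, Integrable (fun D : Fin n → Ω =>
      if empPatternProb V D u < patternProb P V u / 2 then (1 : ℝ) else 0) μ :=
    fun u => hint fun s => if emp s u < patternProb P V u / 2 then (1 : ℝ) else 0
  refine ⟨hgap, ?_⟩
  -- Three moments, each with constant `23 / 5`, give `69 / 5`.
  have haccInt : ∀ i, 2 ^ m * ∫ D : Fin n → Ω, |estAccuracy V t D i - a i| ∂μ ≤
      69 / 5 / (c₁ * e) / (Real.sqrt n * cp) := by
    intro i
    obtain ⟨h1, h2, h3⟩ := ht i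
    have hle : ∫ D : Fin n → Ω, |estAccuracy V t D i - a i| ∂μ ≤ 1 / (c₁ * e) *
        (23 / 5 / Real.sqrt (n * overlap P V i (t i).1) +
          23 / 5 / Real.sqrt (n * overlap P V i (t i).2) +
          23 / 5 / Real.sqrt (n * overlap P V (t i).1 (t i).2)) := by
      refine (integral_mono (hacc i) ((((hmom _ _).add (hmom _ _)).add (hmom _ _)).const_mul _)
        fun D => h.abs_estAccuracy_sub_le hY hV ht he hea hc₁ hcm D i).trans ?_
      rw [integral_const_mul]
      simp only [Pi.add_apply]
      rw [integral_add_three (hmom _ _) (hmom _ _) (hmom _ _)]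
      have := integral_abs_empMoment_sub_le h hY hV hn h1.symm
      have := integral_abs_empMoment_sub_le h hY hV hn h2.symm
      have := integral_abs_empMoment_sub_le h hY hV hn h3
      gcongr
    calc _ ≤ (2 : ℝ) ^ m * (1 / (c₁ * e) *
          (23 / 5 / Real.sqrt (n * overlap P V i (t i).1) +
            23 / 5 / Real.sqrt (n * overlap P V i (t i).2) +
            23 / 5 / Real.sqrt (n * overlap P V (t i).1 (t i).2))) := by gcongr
      _ = 1 / (c₁ * e) * (2 ^ m * (23 / 5 / Real.sqrt (n * overlap P V i (t i).1)) +
            2 ^ m * (23 / 5 / Real.sqrt (n * overlap P V i (t i).2)) +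
            2 ^ m * (23 / 5 / Real.sqrt (n * overlap P V (t i).1 (t i).2))) := by ring
      _ ≤ 1 / (c₁ * e) * (23 / 5 / (Real.sqrt n * cp) + 23 / 5 / (Real.sqrt n * cp) +
            23 / 5 / (Real.sqrt n * cp)) := by
        gcongr <;> exact h.two_pow_div_sqrt_overlap_le hY hV hn _ _
      _ = _ := by ring
  have hbadInt : ∀ u, ∫ D : Fin n → Ω,
      (if empPatternProb V D u < patternProb P V u / 2 then (1 : ℝ) else 0) ∂μ ≤
      400 / 9 / (n * cp) ^ 2 := by
    intro u
    have hm : MeasurableSet {D : Fin n → Ω | empPatternProb V D u < patternProb P V u / 2} :=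
      measurableSet_finiteValued (measurableSet_sample hpat)
        fun s => emp s u < patternProb P V u / 2
    rw [← measureReal_eq_integral hm]
    have htail := measureReal_count_lt_half_le (P := P) (n := n) hpat fun s => s = u
    have hset : {D : Fin n → Ω | empPatternProb V D u < patternProb P V u / 2} =
        {D | ∑ k, (if pattern V (D k) = u then (1 : ℝ) else 0) <
          n * P.real {ω | pattern V ω = u} / 2} := by
      ext D
      simp only [Set.mem_ofPred_eq, empPatternProb, patternProb]
      rw [div_lt_iff₀ hn0]
      ring_nf
    have hcpu : cp ≤ P.real {ω | pattern V ω = u} :=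
      minPatternProb_le u (h.patternProb_pos hY hV u)
    rw [hset]
    refine htail.trans (le_trans (Real.exp_le_exp.2 ?_) (exp_tail_le_inv_sq (mul_pos hn0 hcp)))
    have := mul_le_mul_of_nonneg_left hcpu hn0.le
    linarith
  have hterm : ∀ u, Integrable (fun D : Fin n → Ω =>
      (∏ i, voteBound (c i) (u i)) * ∑ i, |estAccuracy V t D i - a i| +
      2 * |empPatternProb V D u - patternProb P V u| + patternProb P V u *
        (n * if empPatternProb V D u < patternProb P V u / 2 then 1 else 0)) μ := fun u =>
    (((integrable_finsetSum _ fun i _ => hacc i).const_mul _).add ((hemp u).const_mul _)).add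
      (((hbad u).const_mul _).const_mul _)
  refine (integral_mono hgap (integrable_finsetSum _ fun u _ => hterm u)
    fun D => h.riskGap_le hY hV hb t hn D).trans ?_
  rw [integral_finsetSum _ fun u _ => hterm u]
  have hint_term : ∀ u, ∫ D : Fin n → Ω, ((∏ i, voteBound (c i) (u i)) *
      ∑ i, |estAccuracy V t D i - a i| +
      2 * |empPatternProb V D u - patternProb P V u| + patternProb P V u *
        (n * if empPatternProb V D u < patternProb P V u / 2 then 1 else 0)) ∂μ ≤
      (∏ i, voteBound (c i) (u i)) * ∑ i, ∫ D : Fin n → Ω, |estAccuracy V t D i - a i| ∂μ +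
      1 / Real.sqrt n + patternProb P V u * (n * (400 / 9 / (n * cp) ^ 2)) := by
    intro u
    rw [integral_add_three ((integrable_finsetSum _ fun i _ => hacc i).const_mul _)
        ((hemp u).const_mul _) (((hbad u).const_mul _).const_mul _), integral_const_mul, integral_const_mul, integral_const_mul,
      integral_const_mul, integral_finsetSum _ fun i _ => hacc i]
    have h1 : 2 * ∫ D : Fin n → Ω, |empPatternProb V D u - patternProb P V u| ∂μ ≤
        1 / Real.sqrt n := by
      have := integral_abs_empPatternProb_sub_le (P := P) hV hn u
      calc _ ≤ 2 * (1 / (2 * Real.sqrt n)) := by gcongr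
        _ = _ := by field_simp
    have h2 := mul_le_mul_of_nonneg_left (mul_le_mul_of_nonneg_left (hbadInt u) hn0.le)
      (h.patternProb_pos hY hV u).le
    exact add_le_add (add_le_add le_rfl h1) h2
  refine (Finset.sum_le_sum fun u _ => hint_term u).trans ?_
  rw [Finset.sum_add_distrib, Finset.sum_add_distrib, ← Finset.sum_mul, ← Finset.sum_mul,
    sum_patternProb hV]
  refine add_le_add (add_le_add ?_ ?_) ?_
  · have hnn : 0 ≤ ∑ i, ∫ D : Fin n → Ω, |estAccuracy V t D i - a i| ∂μ :=
      Finset.sum_nonneg fun i _ => integral_nonneg fun D => abs_nonneg _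
    calc _ ≤ (2 : ℝ) ^ m * ∑ i, ∫ D : Fin n → Ω, |estAccuracy V t D i - a i| ∂μ :=
          mul_le_mul_of_nonneg_right (sum_prod_voteBound_le c hc) hnn
      _ = ∑ i, (2 : ℝ) ^ m * ∫ D : Fin n → Ω, |estAccuracy V t D i - a i| ∂μ := Finset.mul_sum ..
      _ ≤ ∑ _i : Fin m, 69 / 5 / (c₁ * e) / (Real.sqrt n * cp) :=
          Finset.sum_le_sum fun i _ => haccInt i
      _ = _ := by simp; ring
  -- Each pattern contributes `1 / √n`; the number of patterns is at most `1 / c_p`.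
  · have hcard := h.card_mul_minPatternProb_le hY hV
    have hsn := Real.sqrt_pos.2 hn0
    rw [Finset.sum_const, Finset.card_univ, nsmul_eq_mul, mul_one_div,
      div_le_div_iff₀ hsn (by positivity)]
    have := mul_le_mul_of_nonneg_right hcard hsn.le
    linarith
  · apply le_of_eq
    field_simp

/-- The constant of the theorem dominates the one obtained from second moments; `x` plays the role
of the minimal overlap times its extension factor. -/
theorem rate_le {m n : ℕ} {δ e c₁ cp x c₂ : ℝ} (hm : 3 ≤ m) (hn : 1 ≤ n) (hδ : 0 < δ) (hδ1 : δ < 1)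
    (he : 0 < e) (he1 : e ≤ 1) (hc₁ : 0 < c₁) (hc₁1 : c₁ ≤ 1) (hε : epsn δ n < cp)
    (hx : 0 < x) (hx2 : x ≤ 2) (hc₂ : 0 ≤ c₂) :
    69 / 5 * m / (c₁ * e) / (Real.sqrt n * cp) +
      1 / (Real.sqrt n * cp) + 400 / 9 / (n * cp ^ 2) ≤
    1 / (cp - epsn δ n) * (81 * Real.sqrt Real.pi / (2 * e * c₁ ^ 2) *
      (m / Real.sqrt (n * x)) + epsn δ n * c₂) := by
  have hn0 : (0 : ℝ) < n := by exact_mod_cast hn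
  have hsn := Real.sqrt_pos.2 hn0
  have hε0 : 0 ≤ epsn δ n := Real.sqrt_nonneg _
  have hcp : 0 < cp := hε0.trans_lt hε
  have hm3 : (3 : ℝ) ≤ m := by exact_mod_cast hm
  -- the sample is large in terms of `cp`
  have hlarge : 29 / 50 ≤ Real.sqrt n * cp := by
    have h1 : (29 / 50 : ℝ) ≤ Real.sqrt n * epsn δ n := by
      rw [epsn, ← Real.sqrt_mul hn0.le]
      apply Real.le_sqrt_of_sq_le
      have hlog : Real.log 2 ≤ Real.log (2 / δ) :=
        Real.log_le_log two_pos (by rw [le_div_iff₀ hδ]; linarith)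
      have : (n : ℝ) * (Real.log (2 / δ) / (2 * n)) = Real.log (2 / δ) / 2 := by field_simp
      rw [this]
      linarith [Real.log_two_gt_d9]
    have := mul_le_mul_of_nonneg_left hε.le hsn.le
    linarith
  set r := Real.sqrt n * cp with hr
  have hr0 : 0 < r := mul_pos hsn hcp
  have hrr : (n : ℝ) * cp ^ 2 = r * r := by
    rw [hr]; nlinarith [Real.mul_self_sqrt hn0.le]
  have hec : 0 < e * c₁ ^ 2 := by positivity
  have hec1 : e * c₁ ^ 2 ≤ c₁ * e := by nlinarith [mul_pos he hc₁]
  have hec2 : e * c₁ ^ 2 ≤ 1 := mul_le_one₀ he1 (by positivity) (pow_le_one₀ hc₁.le hc₁1)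
  have hA : 69 / 5 * m / (c₁ * e) / r + 1 / r + 400 / 9 / (n * cp ^ 2) ≤
      40 * m / (e * c₁ ^ 2) / r := by
    -- Since `r ≥ 29 / 50`, one power of `1 / r` can be traded for a constant: `400 / 9 / (29 / 50)
    -- < 77`.
    have h3 : 400 / 9 / (n * cp ^ 2) ≤ 77 / r := by
      rw [hrr, div_le_div_iff₀ (by positivity) hr0]
      nlinarith
    have h4 : 69 / 5 * m / (c₁ * e) ≤ 69 / 5 * m / (e * c₁ ^ 2) := by gcongr
    -- The remaining constant `1 + 77` is absorbed because `m ≥ 3` and `e * c₁ ^ 2 ≤ 1`.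
    have h5 : 78 ≤ 26 * m / (e * c₁ ^ 2) := by
      rw [le_div_iff₀ hec]; nlinarith
    calc _ ≤ 69 / 5 * m / (e * c₁ ^ 2) / r + 1 / r + 77 / r := by gcongr
      _ = (69 / 5 * m / (e * c₁ ^ 2) + 78) / r := by ring
      _ ≤ (69 / 5 * m / (e * c₁ ^ 2) + 26 * m / (e * c₁ ^ 2)) / r := by gcongr
      _ = (199 / 5 * m / (e * c₁ ^ 2)) / r := by ring
      _ ≤ _ := by gcongr; norm_num
  refine hA.trans ?_
  have hpi : (177 / 100 : ℝ) ≤ Real.sqrt Real.pi :=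
    Real.le_sqrt_of_sq_le (by linarith [Real.pi_gt_d2])
  have hsx : Real.sqrt x ≤ 71 / 50 := by
    rw [Real.sqrt_le_iff]; constructor <;> linarith
  have hsx0 := Real.sqrt_pos.2 hx
  have hB : 40 * m / (e * c₁ ^ 2) / Real.sqrt n ≤
      81 * Real.sqrt Real.pi / (2 * e * c₁ ^ 2) * (m / Real.sqrt (n * x)) := by
    rw [Real.sqrt_mul hn0.le]
    have : 81 * Real.sqrt Real.pi / (2 * e * c₁ ^ 2) * (m / (Real.sqrt n * Real.sqrt x)) =
        81 * Real.sqrt Real.pi / (2 * Real.sqrt x) * m / (e * c₁ ^ 2) / Real.sqrt n := by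
      field_simp
    rw [this]
    -- This is where `x ≤ 2` enters: `81 * 1.77 / (2 * 1.42)` exceeds `40`.
    have : 40 ≤ 81 * Real.sqrt Real.pi / (2 * Real.sqrt x) := by
      rw [le_div_iff₀ (by positivity)]; linarith
    gcongr
  have hC : 0 ≤ epsn δ n * c₂ := mul_nonneg hε0 hc₂
  have hd : 0 < cp - epsn δ n := by linarith
  calc 40 * m / (e * c₁ ^ 2) / r = 1 / cp * (40 * m / (e * c₁ ^ 2) / Real.sqrt n) := by
        rw [hr]; field_simp
    _ ≤ 1 / (cp - epsn δ n) * (40 * m / (e * c₁ ^ 2) / Real.sqrt n) := by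
        gcongr; linarith
    _ ≤ _ := by gcongr; linarith

theorem HasFactorLaw.meanLabelProb_nonneg (h : HasFactorLaw P Y V a c)
    (hY : ∀ y, MeasurableSet (Y ⁻¹' {y})) (hV : ∀ j s, MeasurableSet (V j ⁻¹' {s}))
    (hb : P.real {ω | Y ω = 1} = 1 / 2) : 0 ≤ meanLabelProb P Y V := by
  refine integral_nonneg fun ω => ?_
  dsimp only
  rw [h.labelProb_eq hY hV hb]
  have := Finset.prod_pos fun i (_ : i ∈ Finset.univ) => voteFactor_pos (h.1 i) (pattern V ω i)
  have := h.patternProb_pos hY hV (pattern V ω)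
  simp only [pattern] at *
  positivity

/-- The bound on the estimation error. It already holds for the unconditional expectation over data
sets, because data sets with a small empirical frequency are exponentially unlikely, so the event
may be taken to be the whole space. -/
theorem HasFactorLaw.estimationErrorAtMost (h : HasFactorLaw P Y V a c)
    (hY : ∀ y, MeasurableSet (Y ⁻¹' {y})) (hV : ∀ j s, MeasurableSet (V j ⁻¹' {s}))
    (hb : P.real {ω | Y ω = 1} = 1 / 2) (hm : 3 ≤ m) {t : Fin m → Fin m × Fin m}
    (ht : IsTripletChoice P V t) {e c₁ : ℝ} (he : 0 < e)
    (hea : ∀ i, e ≤ signedAccuracy P Y (V i)) (hc₁ : 0 < c₁)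
    (hcm : ∀ j k, j ≠ k → c₁ ≤ moment P (V j) (V k)) (hn : 1 ≤ n) {δ x : ℝ} (hδ : 0 < δ)
    (hδ1 : δ < 1) (hε : epsn δ n < minPatternProb P V) (hx : 0 < x) (hx2 : x ≤ 2) :
    EstimationErrorAtMost P Y V t n δ (1 / (minPatternProb P V - epsn δ n) *
      (81 * Real.sqrt Real.pi / (2 * e * c₁ ^ 2) * (m / Real.sqrt (n * x)) +
        epsn δ n * meanLabelProb P Y V)) := by
  obtain ⟨hint, hle⟩ :=
    h.integral_riskGap_le hY hV hb (fun i => (ht i).1) he hea hc₁ hcm hn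
  refine ⟨hint, Set.univ, MeasurableSet.univ, ?_, ?_⟩
  · simp; linarith
  rw [ProbabilityTheory.cond_univ]
  have h0 := h.1 ⟨0, by omega⟩
  have h1 := h.1 ⟨1, by omega⟩
  refine hle.trans (rate_le hm hn hδ hδ1 he ?_ hc₁ ?_ hε hx hx2 (h.meanLabelProb_nonneg hY hV hb))
  · have := hea ⟨0, by omega⟩
    rw [h.signedAccuracy_eq hY hV] at this
    linarith
  · have hne : (⟨0, by omega⟩ : Fin m) ≠ ⟨1, by omega⟩ := by simp
    refine (hcm _ _ hne).trans ?_
    rw [h.moment_eq hY hV hne]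
    have hp := hea ⟨1, by omega⟩
    rw [h.signedAccuracy_eq hY hV] at hp
    exact mul_le_one₀ (by linarith) (by linarith) (by linarith)

theorem HasFactorLaw.minOverlap_mem (h : HasFactorLaw P Y V a c)
    (hY : ∀ y, MeasurableSet (Y ⁻¹' {y})) (hV : ∀ j s, MeasurableSet (V j ⁻¹' {s}))
    (hm : 3 ≤ m) : 0 < minOverlap P V ∧ minOverlap P V ≤ 1 := by
  have hne : Nonempty (Fin m) := ⟨⟨0, by omega⟩⟩
  have hne' : ∀ i : Fin m, Nonempty {j : Fin m // j ≠ i} := fun i => by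
    have : Nontrivial (Fin m) := Fin.nontrivial_iff_two_le.2 (by omega)
    obtain ⟨j, hj⟩ := exists_ne i
    exact ⟨⟨j, hj⟩⟩
  obtain ⟨i, hi⟩ := exists_eq_ciInf_of_finite
    (f := fun i : Fin m => ⨆ j : {j : Fin m // j ≠ i}, overlap P V i j)
  obtain ⟨j, hj⟩ := exists_eq_ciSup_of_finite (f := fun j : {j : Fin m // j ≠ i} => overlap P V i j)
  rw [minOverlap, ← hi, ← hj]
  refine ⟨?_, measureReal_le_one⟩
  rw [h.overlap_eq hY hV j.2.symm]
  exact mul_pos (h.1 i).2.2.1 (h.1 j).2.2.1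

end Estimation

/-! ### The sources other than `i`: their likelihoods, posterior and performance. -/

section Others

variable {Ω : Type*} [MeasurableSpace Ω] {P : Measure Ω} [IsProbabilityMeasure P]
  {Y : Ω → ℤˣ} {m : ℕ} {V : Fin m → Ω → SignType} {a c : Fin m → ℝ}

/-- The votes of all sources other than `i`. -/
def otherVotes {Ω : Type*} {m : ℕ} (V : Fin m → Ω → SignType) (i : Fin m) (ω : Ω) :
    {j : Fin m // j ≠ i} → SignType := fun j => V j ω

/-- The model probability of the votes `u` of the sources other than `i`, given the label `y`. -/
def otherFactor {m : ℕ} (a c : Fin m → ℝ) (i : Fin m) (y : ℤˣ)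
    (u : {j : Fin m // j ≠ i} → SignType) : ℝ :=
  ∏ j : {j : Fin m // j ≠ i}, voteFactor (a j) (c j) (relVote y (u j))

/-- The posterior of `Y = 1` given the votes of the sources other than `i`. -/
def otherProb {m : ℕ} (a c : Fin m → ℝ) (i : Fin m) (u : {j : Fin m // j ≠ i} → SignType) : ℝ :=
  otherFactor a c i 1 u / (otherFactor a c i 1 u + otherFactor a c i (-1) u)

theorem measurableSet_otherVotes (hV : ∀ j s, MeasurableSet (V j ⁻¹' {s})) (i : Fin m)
    (u : {j : Fin m // j ≠ i} → SignType) : MeasurableSet (otherVotes V i ⁻¹' {u}) := by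
  have : otherVotes V i ⁻¹' {u} = ⋂ j : {j : Fin m // j ≠ i}, V j ⁻¹' {u j} := by
    ext ω
    rw [Set.mem_preimage, Set.mem_singleton_iff, funext_iff, Set.mem_iInter]
    rfl
  rw [this]
  exact MeasurableSet.iInter fun j => hV j _

theorem HasFactorLaw.otherFactor_pos {Ω : Type*} [MeasurableSpace Ω] {P : Measure Ω} {Y : Ω → ℤˣ}
    {m : ℕ} {V : Fin m → Ω → SignType} {a c : Fin m → ℝ} (h : HasFactorLaw P Y V a c) (i : Fin m) (y : ℤˣ)
    (u : {j : Fin m // j ≠ i} → SignType) : 0 < otherFactor a c i y u :=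
  Finset.prod_pos fun j _ => voteFactor_pos (h.1 j) _

theorem sum_otherFactor (a c : Fin m → ℝ) (i : Fin m) (y : ℤˣ) :
    ∑ u, otherFactor a c i y u = 1 := by
  simp only [otherFactor]
  rw [← Fintype.prod_sum fun (j : {j : Fin m // j ≠ i}) t =>
    voteFactor (a j) (c j) (relVote y t)]
  simp [sum_voteFactor]

theorem relVote_neg (y : ℤˣ) (s : SignType) : relVote y (-s) = relVote (-y) s := by
  rcases Int.units_eq_one_or y with rfl | rfl <;>
    simp [relVote, show ((-1 : ℤˣ) = 1) = False by decide]

/-- Flipping all votes exchanges the two labels. With `sum_comp_neg_votes` this turns averages given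
`Y = -1` into averages given `Y = 1`. -/
theorem otherFactor_neg (a c : Fin m → ℝ) (i : Fin m) (y : ℤˣ)
    (u : {j : Fin m // j ≠ i} → SignType) :
    otherFactor a c i y (fun j => -u j) = otherFactor a c i (-y) u := by
  simp only [otherFactor, relVote_neg]

theorem sum_comp_neg_votes {ι : Type*} [Fintype ι] [DecidableEq ι]
    (F : (ι → SignType) → ℝ) : ∑ u : ι → SignType, F (fun j => -u j) = ∑ u, F u :=
  Equiv.sum_comp (Function.Involutive.toPerm (fun (u : ι → SignType) j => -u j)
    fun u => funext fun j => neg_neg (u j)) F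

theorem prod_voteFactor_eq_mul_otherFactor (a c : Fin m → ℝ) (i : Fin m) (y : ℤˣ)
    (s : Fin m → SignType) :
    ∏ j, voteFactor (a j) (c j) (relVote y (s j)) =
      voteFactor (a i) (c i) (relVote y (s i)) * otherFactor a c i y fun j => s j :=
  Fintype.prod_eq_mul_prod_subtype_ne _ i

theorem HasFactorLaw.otherVotes_law (h : HasFactorLaw P Y V a c)
    (hY : ∀ y, MeasurableSet (Y ⁻¹' {y})) (hV : ∀ j s, MeasurableSet (V j ⁻¹' {s}))
    (i : Fin m) (y : ℤˣ) (u : {j : Fin m // j ≠ i} → SignType) :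
    P.real {ω | (Y ω, otherVotes V i ω) = (y, u)} = 1 / 2 * otherFactor a c i y u := by
  have h1 := h.marginal hY hV (Finset.univ.filter (· ≠ i)) y
    fun j => if hj : j ≠ i then u ⟨j, hj⟩ else 0
  rw [Finset.prod_subtype (p := (· ≠ i)) _ (by simp)] at h1
  have hset : {ω | (Y ω, otherVotes V i ω) = (y, u)} = {ω | Y ω = y ∧
      ∀ j ∈ Finset.univ.filter (· ≠ i), V j ω = if hj : j ≠ i then u ⟨j, hj⟩ else 0} := by
    ext ω
    simp only [Set.mem_ofPred_eq, Prod.mk.injEq, otherVotes, funext_iff, Subtype.forall,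
      Finset.mem_filter, Finset.mem_univ, true_and]
    refine and_congr_right fun _ => forall₂_congr fun j hj => ?_
    rw [dif_pos hj]
  rw [hset, h1]
  congr 1
  refine Finset.prod_congr rfl fun j _ => ?_
  rw [dif_pos j.2]

theorem HasFactorLaw.othersPosterior_eq (h : HasFactorLaw P Y V a c)
    (hY : ∀ y, MeasurableSet (Y ⁻¹' {y})) (hV : ∀ j s, MeasurableSet (V j ⁻¹' {s}))
    (i : Fin m) (ω : Ω) :
    othersPosterior P Y V i ω = otherProb a c i (otherVotes V i ω) := by
  have hU := measurableSet_otherVotes hV i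
  set u := otherVotes V i ω
  have hset : {ω' | ∀ j, j ≠ i → V j ω' = V j ω} = {ω' | otherVotes V i ω' = u} := by
    ext ω'
    simp [u, otherVotes, funext_iff]
  have h1 := measureReal_finiteValued P (measurableSet_preimage_prodMk hY hU) fun w => w.2 = u
  rw [Fintype.sum_prod_type] at h1
  simp only [Finset.sum_ite_eq', Finset.mem_univ, if_true, h.otherVotes_law hY hV,
    sum_units_int] at h1
  have h2 := h.otherVotes_law hY hV i 1 u
  have h3 : {ω' | otherVotes V i ω' = u} ∩ {ω' | Y ω' = 1} =
      {ω' | (Y ω', otherVotes V i ω') = (1, u)} := by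
    ext ω'; simp [and_comm]
  have h4 : MeasurableSet {ω' | otherVotes V i ω' = u} := hU u
  rw [othersPosterior, hset, measureReal_cond_eq P h4, h3, h1, h2, otherProb]
  have := h.otherFactor_pos i 1 u
  have := h.otherFactor_pos i (-1) u
  field_simp

theorem HasFactorLaw.labelModel_eq (h : HasFactorLaw P Y V a c)
    (hY : ∀ y, MeasurableSet (Y ⁻¹' {y})) (hV : ∀ j s, MeasurableSet (V j ⁻¹' {s}))
    (hb : P.real {ω | Y ω = 1} = 1 / 2) (i : Fin m) (ω : Ω) :
    labelModel P Y V ω = 2 * (voteFactor (a i) (c i) (V i ω) *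
      otherFactor a c i 1 (otherVotes V i ω) / (voteFactor (a i) (c i) (V i ω) *
      otherFactor a c i 1 (otherVotes V i ω) + voteFactor (a i) (c i) (-V i ω) *
      otherFactor a c i (-1) (otherVotes V i ω))) - 1 := by
  rw [labelModel, h.labelProb_eq hY hV hb, h.patternProb_eq hY hV]
  have h1 := prod_voteFactor_eq_mul_otherFactor a c i 1 (pattern V ω)
  rw [prod_voteFactor_eq_mul_otherFactor]
  simp only [relVote, if_true, show ((-1 : ℤˣ) = 1) = False by decide, if_false] at h1 ⊢
  rw [h1, show (fun j : {j : Fin m // j ≠ i} => pattern V ω j) = otherVotes V i ω from rfl,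
    show pattern V ω i = V i ω from rfl]
  have := mul_pos (voteFactor_pos (h.1 i) (V i ω)) (h.otherFactor_pos i 1 (otherVotes V i ω))
  have := mul_pos (voteFactor_pos (h.1 i) (-V i ω))
    (h.otherFactor_pos i (-1) (otherVotes V i ω))
  congr 2
  rw [div_eq_div_iff (by positivity) (by positivity)]
  ring

theorem HasFactorLaw.labelModel_eq_of_abstain (h : HasFactorLaw P Y V a c)
    (hY : ∀ y, MeasurableSet (Y ⁻¹' {y})) (hV : ∀ j s, MeasurableSet (V j ⁻¹' {s}))
    (hb : P.real {ω | Y ω = 1} = 1 / 2) (i : Fin m) {ω : Ω} (hω : V i ω = 0) :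
    labelModel P Y V ω = 2 * otherProb a c i (otherVotes V i ω) - 1 := by
  rw [h.labelModel_eq hY hV hb i, hω, neg_zero, otherProb, ← mul_add,
    mul_div_mul_left _ _ (voteFactor_pos (h.1 i) 0).ne']

theorem HasFactorLaw.otherProb_mem {Ω : Type*} [MeasurableSpace Ω] {P : Measure Ω} {Y : Ω → ℤˣ}
    {m : ℕ} {V : Fin m → Ω → SignType} {a c : Fin m → ℝ} (h : HasFactorLaw P Y V a c) (i : Fin m)
    (u : {j : Fin m // j ≠ i} → SignType) : otherProb a c i u ∈ Set.Icc (0 : ℝ) 1 := by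
  have h1 := h.otherFactor_pos i 1 u
  have h2 := h.otherFactor_pos i (-1) u
  refine ⟨div_nonneg h1.le (by linarith), ?_⟩
  rw [otherProb, div_le_one (by linarith)]
  linarith

/-- Conditioning on a posterior of at least `1 / 2` increases the mean posterior. -/
theorem HasFactorLaw.othersPerformance_bounds (h : HasFactorLaw P Y V a c)
    (hY : ∀ y, MeasurableSet (Y ⁻¹' {y})) (hV : ∀ j s, MeasurableSet (V j ⁻¹' {s}))
    (i : Fin m) : othersPerformance P Y V i ≤ 1 ∧ 0 ≤ othersPerformance P Y V i ∧
      ∑ u, otherFactor a c i 1 u * otherProb a c i u ≤ othersPerformance P Y V i := by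
  have hU := measurableSet_otherVotes hV i
  have hW := measurableSet_preimage_prodMk hY hU
  set R := otherFactor a c i 1
  set p := otherProb a c i
  have hR : ∀ u, 0 < R u := h.otherFactor_pos i 1
  have hp : ∀ u, p u ∈ Set.Icc (0 : ℝ) 1 := h.otherProb_mem i
  set A0 := ∑ u, if 1 / 2 ≤ p u then R u else 0
  set A1 := ∑ u, if 1 / 2 ≤ p u then R u * p u else 0
  have hpost : ∀ ω, othersPosterior P Y V i ω = p (otherVotes V i ω) :=
    h.othersPosterior_eq hY hV i
  have hSm : MeasurableSet {ω | Y ω = 1 ∧ 1 / 2 ≤ p (otherVotes V i ω)} :=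
    measurableSet_finiteValued hW fun w => w.1 = 1 ∧ 1 / 2 ≤ p w.2
  have hPS : P.real {ω | Y ω = 1 ∧ 1 / 2 ≤ p (otherVotes V i ω)} = 1 / 2 * A0 := by
    have h1 := measureReal_finiteValued P hW fun w => w.1 = 1 ∧ 1 / 2 ≤ p w.2
    rw [Fintype.sum_prod_type, sum_units_int] at h1
    simp only [h.otherVotes_law hY hV, show ((-1 : ℤˣ) = 1) = False by decide, true_and,
      false_and, if_false, Finset.sum_const_zero, add_zero] at h1
    rw [h1, Finset.mul_sum]
    refine Finset.sum_congr rfl fun u _ => ?_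
    split_ifs <;> simp [R]
  have hint : ∫ ω in {ω | Y ω = 1 ∧ 1 / 2 ≤ p (otherVotes V i ω)}, p (otherVotes V i ω) ∂P =
      1 / 2 * A1 := by
    rw [← integral_indicator hSm]
    have h1 := integral_finiteValued P hW fun w => if w.1 = 1 ∧ 1 / 2 ≤ p w.2 then p w.2 else 0
    rw [Fintype.sum_prod_type, sum_units_int] at h1
    simp only [h.otherVotes_law hY hV, show ((-1 : ℤˣ) = 1) = False by decide, true_and,
      false_and, if_false, mul_zero, Finset.sum_const_zero, add_zero] at h1
    have h2 : (Set.indicator {ω | Y ω = 1 ∧ 1 / 2 ≤ p (otherVotes V i ω)}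
        fun ω => p (otherVotes V i ω)) =
        fun ω => if Y ω = 1 ∧ 1 / 2 ≤ p (otherVotes V i ω) then p (otherVotes V i ω) else 0 := by
      funext ω; simp [Set.indicator]
    rw [h2, h1, Finset.mul_sum]
    refine Finset.sum_congr rfl fun u _ => ?_
    split_ifs <;> simp [R, mul_assoc]
  have hC : othersPerformance P Y V i = A1 / A0 := by
    rw [othersPerformance, integral_cond_eq]
    simp only [hpost]
    rw [hPS, hint, ← div_eq_inv_mul, mul_div_mul_left _ _ (by norm_num)]
  -- The pattern in which all other sources abstain has posterior exactly `1 / 2`, so the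
  -- conditioning event is not null.
  have hA0 : 0 < A0 := by
    have hp0 : p (fun _ => 0) = 1 / 2 := by
      have h1 := h.otherFactor_pos i 1 fun _ => 0
      have h2 : otherFactor a c i (-1) (fun _ => 0) = otherFactor a c i 1 fun _ => 0 := by
        simp [otherFactor, relVote]
      simp only [p, otherProb, h2]
      field_simp
      norm_num
    refine lt_of_lt_of_le (hR fun _ => 0) ?_
    calc R (fun _ => 0) = if 1 / 2 ≤ p (fun _ => 0) then R (fun _ => 0) else 0 := by
          rw [if_pos hp0.ge]
      _ ≤ A0 := Finset.single_le_sum (f := fun u => if 1 / 2 ≤ p u then R u else 0)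
          (fun u _ => by split_ifs; exacts [(hR u).le, le_rfl]) (Finset.mem_univ _)
  have hA1 : A1 ≤ A0 := by
    refine Finset.sum_le_sum fun u _ => ?_
    split_ifs
    · exact mul_le_of_le_one_right (hR u).le (hp u).2
    · rfl
  have hA1' : 1 / 2 * A0 ≤ A1 := by
    rw [Finset.mul_sum]
    refine Finset.sum_le_sum fun u _ => ?_
    split_ifs with hu
    · nlinarith [hR u]
    · simp
  rw [hC]
  set C := A1 / A0
  have hCA : C * A0 = A1 := div_mul_cancel₀ _ hA0.ne'
  have hC2 : 1 / 2 ≤ C := by rw [le_div_iff₀ hA0]; exact hA1'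
  refine ⟨by rw [div_le_one hA0]; exact hA1, by linarith, ?_⟩
  -- Discarded patterns have posterior below `1 / 2`, hence below the mean `C ≥ 1 / 2` of the
  -- retained ones.
  have hpt : ∀ u, R u * p u ≤ R u * C + ((if 1 / 2 ≤ p u then R u * p u else 0) -
      C * if 1 / 2 ≤ p u then R u else 0) := by
    intro u
    split_ifs with hu
    · linarith
    · push Not at hu
      have := mul_le_mul_of_nonneg_left (hu.le.trans hC2) (hR u).le
      linarith
  refine (Finset.sum_le_sum fun u _ => hpt u).trans ?_
  rw [Finset.sum_add_distrib, Finset.sum_sub_distrib, ← Finset.sum_mul, ← Finset.mul_sum,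
    sum_otherFactor]
  change 1 * C + (A1 - C * A0) ≤ C
  linarith

end Others

/-! ### Balance of coverage and of correct votes under an extension. -/

section Extension

variable {Ω : Type*} [MeasurableSpace Ω] {P : Measure Ω} [IsProbabilityMeasure P] {Y : Ω → ℤˣ}

theorem accuracy_mul_coverage {v : Ω → SignType} (hv : ∀ s, MeasurableSet (v ⁻¹' {s})) :
    accuracy P Y v * coverage P v = P.real {ω | v ω ≠ 0 ∧ ((v ω : SignType) : ℤ) = (Y ω : ℤ)} := by
  have hm : MeasurableSet {ω | v ω ≠ 0} := measurableSet_finiteValued hv fun s => s ≠ 0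
  rw [accuracy, measureReal_cond_eq P hm, ← coverage, ← Set.ofPred_and]
  by_cases h0 : coverage P v = 0
  · rw [h0, mul_zero]
    refine (le_antisymm ?_ measureReal_nonneg).symm
    rw [← h0]
    exact measureReal_mono fun ω hω => hω.1
  · field_simp

variable {v w : Ω → SignType}

theorem coverage_extension (hv : ∀ s, MeasurableSet (v ⁻¹' {s}))
    (hw : ∀ s, MeasurableSet (w ⁻¹' {s})) (hk : ∀ ω, v ω ≠ 0 → w ω = v ω) :
    coverage P w = coverage P v + P.real {ω | v ω = 0 ∧ w ω ≠ 0} := by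
  have hm : MeasurableSet {ω | v ω = 0 ∧ w ω ≠ 0} := measurableSet_finiteValued
    (measurableSet_preimage_prodMk hv hw) fun s => s.1 = 0 ∧ s.2 ≠ 0
  rw [coverage, coverage, ← measureReal_union _ hm]
  · congr 1
    ext ω
    simp only [Set.mem_union, Set.mem_ofPred_eq]
    by_cases h : v ω = 0
    · simp [h]
    · simp [h, hk ω h]
  · rw [Set.disjoint_left]
    rintro ω h1 ⟨h2, -⟩
    exact h1 h2

theorem correct_extension (hY : ∀ y, MeasurableSet (Y ⁻¹' {y}))
    (hv : ∀ s, MeasurableSet (v ⁻¹' {s}))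
    (hw : ∀ s, MeasurableSet (w ⁻¹' {s})) (hk : ∀ ω, v ω ≠ 0 → w ω = v ω) :
    accuracy P Y w * coverage P w = accuracy P Y v * coverage P v +
      P.real ({ω | v ω = 0 ∧ w ω ≠ 0} ∩ {ω | ((w ω : SignType) : ℤ) = (Y ω : ℤ)}) := by
  have hm : MeasurableSet ({ω | v ω = 0 ∧ w ω ≠ 0} ∩ {ω | ((w ω : SignType) : ℤ) = (Y ω : ℤ)}) :=
    measurableSet_finiteValued (measurableSet_preimage_prodMk
      (measurableSet_preimage_prodMk hv hw) hY)
      fun s => (s.1.1 = 0 ∧ s.1.2 ≠ 0) ∧ ((s.1.2 : SignType) : ℤ) = (s.2 : ℤ)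
  rw [accuracy_mul_coverage hw, accuracy_mul_coverage hv, ← measureReal_union _ hm]
  · congr 1
    ext ω
    simp only [Set.mem_union, Set.mem_inter_iff, Set.mem_ofPred_eq]
    by_cases h : v ω = 0
    · simp [h]
    · simp [h, hk ω h]
  · rw [Set.disjoint_left]
    rintro ω ⟨h1, -⟩ ⟨⟨h2, -⟩, -⟩
    exact h1 h2

end Extension

/-! ### The change of risk on the new region. -/

section Lift

variable {Ω : Type*} [MeasurableSpace Ω] {P : Measure Ω} [IsProbabilityMeasure P]
  {Y : Ω → ℤˣ} {m : ℕ} {V : Fin m → Ω → SignType} {a c a' c' : Fin m → ℝ} {i : Fin m}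
  {ext : Ω → SignType}

theorem measurableSet_update (hV : ∀ j s, MeasurableSet (V j ⁻¹' {s}))
    (hext : ∀ s, MeasurableSet (ext ⁻¹' {s})) (j : Fin m) (s : SignType) :
    MeasurableSet (Function.update V i ext j ⁻¹' {s}) := by
  by_cases hj : j = i
  · subst hj; simpa using hext s
  · simpa [hj] using hV j s

theorem otherVotes_update {Ω : Type*} {m : ℕ} {V : Fin m → Ω → SignType} {i : Fin m}
    {ext : Ω → SignType} : otherVotes (Function.update V i ext) i = otherVotes V i := by
  funext ω j
  simp [otherVotes, j.2]

/-- The parameters are determined by the law of the single source with the label, and source `j` is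
untouched by the extension of source `i`. -/
theorem HasFactorLaw.params_update (h : HasFactorLaw P Y V a c)
    (h' : HasFactorLaw P Y (Function.update V i ext) a' c')
    (hY : ∀ y, MeasurableSet (Y ⁻¹' {y})) (hV : ∀ j s, MeasurableSet (V j ⁻¹' {s}))
    (hext : ∀ s, MeasurableSet (ext ⁻¹' {s})) {j : Fin m} (hj : j ≠ i) :
    a' j = a j ∧ c' j = c j := by
  have hV' := measurableSet_update (i := i) hV hext
  rw [← h'.accuracy_eq hY hV', ← h.accuracy_eq hY hV, ← h'.coverage_eq hY hV',
    ← h.coverage_eq hY hV]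
  simp [hj]

theorem HasFactorLaw.otherFactor_update (h : HasFactorLaw P Y V a c)
    (h' : HasFactorLaw P Y (Function.update V i ext) a' c')
    (hY : ∀ y, MeasurableSet (Y ⁻¹' {y})) (hV : ∀ j s, MeasurableSet (V j ⁻¹' {s}))
    (hext : ∀ s, MeasurableSet (ext ⁻¹' {s})) : otherFactor a' c' i = otherFactor a c i := by
  funext y u
  refine Finset.prod_congr rfl fun j _ => ?_
  obtain ⟨h1, h2⟩ := h.params_update h' hY hV hext j.2
  rw [h1, h2]

/-- Joint law of the label, the new votes and the votes of the other sources on the region where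
source `i` abstains and its extension votes. -/
theorem HasFactorLaw.newRegion_law (h : HasFactorLaw P Y V a c)
    (h' : HasFactorLaw P Y (Function.update V i ext) a' c')
    (hY : ∀ y, MeasurableSet (Y ⁻¹' {y})) (hV : ∀ j s, MeasurableSet (V j ⁻¹' {s}))
    (hext : ∀ s, MeasurableSet (ext ⁻¹' {s})) (hk : ∀ ω, V i ω ≠ 0 → ext ω = V i ω)
    (y : ℤˣ) {t : SignType} (ht : t ≠ 0) (u : {j : Fin m // j ≠ i} → SignType) :
    P.real {ω | (Y ω, V i ω, ext ω, otherVotes V i ω) = (y, 0, t, u)} =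
      1 / 2 * otherFactor a c i y u * (voteFactor (a' i) (c' i) (relVote y t) -
        voteFactor (a i) (c i) (relVote y t)) := by
  let s : Fin m → SignType := fun j => if hj : j ≠ i then u ⟨j, hj⟩ else t
  have hsi : s i = t := by simp [s]
  have hsj : (fun j : {j : Fin m // j ≠ i} => s j) = u := by
    funext j; exact dif_pos j.2
  have hpat : ∀ (V : Fin m → Ω → SignType) ω, pattern V ω = s ↔ V i ω = t ∧ otherVotes V i ω = u := by
    intro V ω
    rw [← hsj, ← hsi]
    constructor
    · intro he
      rw [← he]
      exact ⟨rfl, rfl⟩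
    · rintro ⟨h1, h2⟩
      funext j
      by_cases hj : j = i
      · rw [hj]; exact h1
      · exact congrFun h2 ⟨j, hj⟩
  have e1 := h.2 y s
  have e2 := h'.2 y s
  rw [prod_voteFactor_eq_mul_otherFactor _ _ i, hsi, hsj] at e1 e2
  rw [h.otherFactor_update h' hY hV hext] at e2
  -- The extended source votes `t` either because source `i` did, or on the new region.
  have hsplit : P.real {ω | Y ω = y ∧ pattern (Function.update V i ext) ω = s} =
      P.real {ω | Y ω = y ∧ pattern V ω = s} +
        P.real {ω | (Y ω, V i ω, ext ω, otherVotes V i ω) = (y, 0, t, u)} := by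
    rw [← measureReal_union]
    · congr 1
      ext ω
      simp only [Set.mem_union, Set.mem_ofPred_eq, hpat, otherVotes_update, Function.update_self,
        Prod.mk.injEq]
      by_cases h0 : V i ω = 0
      · simp [h0, ht.symm]
      · simp [h0, hk ω h0]
    · rw [Set.disjoint_left]
      intro ω h1 h2
      simp only [Set.mem_ofPred_eq, hpat, Prod.mk.injEq] at h1 h2
      exact ht (h1.2.1.symm.trans h2.2.1)
    · exact measurableSet_preimage_prodMk hY (measurableSet_preimage_prodMk (hV i)
        (measurableSet_preimage_prodMk hext (measurableSet_otherVotes hV i))) _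
  rw [e1, e2] at hsplit
  linarith

/-- Cauchy-Schwarz in the form `x² / A + y² / B ≥ (x + y)² / (A + B)`, where here `A + B = x + y`.
-/
theorem add_le_sq_div_add_sq_div {x y A B : ℝ} (hA : 0 < A) (hB : 0 < B) (hAB : A + B = x + y)
    (hxy : 0 < x + y) : x + y ≤ x ^ 2 / A + y ^ 2 / B := by
  rw [div_add_div _ _ hA.ne' hB.ne', le_div_iff₀ (by positivity)]
  have : A = x + y - B := by linarith
  subst this
  nlinarith [sq_nonneg (x * B - y * (x + y - B)), mul_pos hA hB, sq_nonneg (x - (x + y - B))]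

/-- Gain from the votes on the new region for fixed votes of the other sources: `R` and `S` are the
likelihoods of these votes under the two labels, `p` and `q` the masses of correct and wrong new
votes. -/
theorem le_posterior_gain {R S p q α : ℝ} (hR : 0 < R) (hS : 0 < S) (hp : 0 ≤ p) (hq : 0 ≤ q)
    (hα : 0 < α) (hα1 : α < 1) :
    (p * α + q * (1 - α)) * (R + S) - (p + q) * ((R ^ 2 + S ^ 2) / (R + S)) ≤
      R * p * (α * R / (α * R + (1 - α) * S) - R / (R + S)) +
      R * q * ((1 - α) * R / ((1 - α) * R + α * S) - R / (R + S)) +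
      S * q * (R / (R + S) - α * R / (α * R + (1 - α) * S)) +
      S * p * (R / (R + S) - (1 - α) * R / ((1 - α) * R + α * S)) := by
  have hα' : 0 < 1 - α := by linarith
  have hA : 0 < α * R + (1 - α) * S := by positivity
  have hB : 0 < (1 - α) * R + α * S := by positivity
  have hRS : 0 < R + S := by positivity
  have h1 := add_le_sq_div_add_sq_div (x := R) (y := S) hA hB (by ring) hRS
  have h2 := add_le_sq_div_add_sq_div (x := R) (y := S) hB hA (by ring) hRS
  have e1 : α * R / (α * R + (1 - α) * S) = 1 - (1 - α) * S / (α * R + (1 - α) * S) := by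
    field_simp; ring
  have e2 : (1 - α) * R / ((1 - α) * R + α * S) = 1 - α * S / ((1 - α) * R + α * S) := by
    field_simp; ring
  -- Regrouped by correct and wrong mass, the gain consists of sums of two quotients whose
  -- denominators add up to `R + S`, as the preceding inequality requires.
  have key : R * p * (α * R / (α * R + (1 - α) * S) - R / (R + S)) +
      R * q * ((1 - α) * R / ((1 - α) * R + α * S) - R / (R + S)) +
      S * q * (R / (R + S) - α * R / (α * R + (1 - α) * S)) +
      S * p * (R / (R + S) - (1 - α) * R / ((1 - α) * R + α * S)) =
      p * α * (R ^ 2 / (α * R + (1 - α) * S) + S ^ 2 / ((1 - α) * R + α * S)) +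
      q * (1 - α) * (R ^ 2 / ((1 - α) * R + α * S) + S ^ 2 / (α * R + (1 - α) * S)) -
      (p + q) * ((R ^ 2 + S ^ 2) / (R + S)) := by
    field_simp
    ring
  rw [key]
  have := mul_le_mul_of_nonneg_left h1 (mul_nonneg hp hα.le)
  have := mul_le_mul_of_nonneg_left h2 (mul_nonneg hq hα'.le)
  linarith

end Lift

section Lift

variable {Ω : Type*} [MeasurableSpace Ω] {P : Measure Ω} [IsProbabilityMeasure P]
  {Y : Ω → ℤˣ} {m : ℕ} {V : Fin m → Ω → SignType} {a c a' c' : Fin m → ℝ} {i : Fin m}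
  {ext : Ω → SignType}

/-- The decrease of the loss on the new region when the new vote is `t`, the votes of the other
sources are `u` and the label is `y`. -/
def lossDecrease {m : ℕ} (a c : Fin m → ℝ) (i : Fin m) (α : ℝ) (y : ℤˣ) (t : SignType)
    (u : {j : Fin m // j ≠ i} → SignType) : ℝ :=
  ((y : ℤ) : ℝ) * ((voteFactor α 1 t * otherFactor a c i 1 u / (voteFactor α 1 t *
    otherFactor a c i 1 u + voteFactor α 1 (-t) * otherFactor a c i (-1) u)) - otherProb a c i u)

/-- For a genuine probability the loss is affine, so a loss difference becomes `y` times a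
difference of posteriors. -/
theorem half_abs_label_sub {p : ℝ} (hp : p ∈ Set.Icc (0 : ℝ) 1) (y : ℤˣ) :
    1 / 2 * |((y : ℤ) : ℝ) - (2 * p - 1)| = 1 / 2 - ((y : ℤ) : ℝ) * (p - 1 / 2) := by
  obtain ⟨h0, h1⟩ := hp
  rcases Int.units_eq_one_or y with rfl | rfl
  · simp only [Units.val_one, Int.cast_one]
    rw [abs_of_nonneg (by linarith)]; ring
  · simp only [Units.val_neg, Units.val_one, Int.cast_neg, Int.cast_one]
    rw [abs_of_nonpos (by linarith)]; ring

theorem voteFactor_eq_mul (a c : ℝ) {t : SignType} (ht : t ≠ 0) :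
    voteFactor a c t = c * voteFactor a 1 t := by
  cases t
  · exact absurd rfl ht
  · simp [voteFactor, mul_comm]
  · simp [voteFactor, mul_comm]

theorem HasFactorLaw.lift_eq_integral (h : HasFactorLaw P Y V a c)
    (h' : HasFactorLaw P Y (Function.update V i ext) a' c')
    (hY : ∀ y, MeasurableSet (Y ⁻¹' {y})) (hV : ∀ j s, MeasurableSet (V j ⁻¹' {s}))
    (hext : ∀ s, MeasurableSet (ext ⁻¹' {s}))
    (hb : P.real {ω | Y ω = 1} = 1 / 2) :
    risk P Y (labelModel P Y V) - risk P Y (extendedModel P Y V i ext) =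
      ∫ ω, (if V i ω = 0 ∧ ext ω ≠ 0 then
        lossDecrease a c i (a' i) (Y ω) (ext ω) (otherVotes V i ω) else 0) ∂P := by
  have hV' := measurableSet_update (i := i) hV hext
  have hW := measurableSet_preimage_prodMk hY (measurableSet_preimage_prodMk (hV i)
    (measurableSet_preimage_prodMk hext (measurableSet_otherVotes hV i)))
  have hf := h.labelModel_eq hY hV hb i
  have hf' := h'.labelModel_eq hY hV' hb i
  rw [otherVotes_update, h.otherFactor_update h' hY hV hext] at hf'
  simp only [Function.update_self] at hf'
  have hint : Integrable (fun ω => 1 / 2 * |((Y ω : ℤ) : ℝ) - labelModel P Y V ω|) P := by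
    simp only [hf]
    exact integrable_finiteValued P hW fun w => 1 / 2 * |((w.1 : ℤ) : ℝ) -
      (2 * (voteFactor (a i) (c i) w.2.1 * otherFactor a c i 1 w.2.2.2 /
        (voteFactor (a i) (c i) w.2.1 * otherFactor a c i 1 w.2.2.2 +
          voteFactor (a i) (c i) (-w.2.1) * otherFactor a c i (-1) w.2.2.2)) - 1)|
  have hint' : Integrable (fun ω => 1 / 2 * |((Y ω : ℤ) : ℝ) - extendedModel P Y V i ext ω|) P := by
    simp only [extendedModel, hf, hf']
    exact integrable_finiteValued P hW fun w => 1 / 2 * |((w.1 : ℤ) : ℝ) -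
      if w.2.1 ≠ 0 then (2 * (voteFactor (a i) (c i) w.2.1 * otherFactor a c i 1 w.2.2.2 /
        (voteFactor (a i) (c i) w.2.1 * otherFactor a c i 1 w.2.2.2 +
          voteFactor (a i) (c i) (-w.2.1) * otherFactor a c i (-1) w.2.2.2)) - 1) else
      (2 * (voteFactor (a' i) (c' i) w.2.2.1 * otherFactor a c i 1 w.2.2.2 /
        (voteFactor (a' i) (c' i) w.2.2.1 * otherFactor a c i 1 w.2.2.2 +
          voteFactor (a' i) (c' i) (-w.2.2.1) * otherFactor a c i (-1) w.2.2.2)) - 1)|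
  rw [risk, risk, ← integral_sub hint hint']
  refine integral_congr_ae (Filter.Eventually.of_forall fun ω => ?_)
  dsimp only
  by_cases h0 : V i ω = 0
  · have e1 : extendedModel P Y V i ext ω = labelModel P Y (Function.update V i ext) ω := by
      simp [extendedModel, h0]
    have e2 := h.labelModel_eq_of_abstain hY hV hb i h0
    -- If both versions of the source abstain, both models reduce to the posterior given the other
    -- votes.
    by_cases ht : ext ω = 0
    · have e3 := h'.labelModel_eq_of_abstain hY hV' hb i
        (ω := ω) (by rw [Function.update_self]; exact ht)
      rw [otherVotes_update, otherProb, h.otherFactor_update h' hY hV hext, ← otherProb] at e3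
      rw [e1, e2, e3, if_neg (by simp [ht]), sub_self]
    · rw [if_pos ⟨h0, ht⟩, e1, e2, hf' ω, half_abs_label_sub (h.otherProb_mem i _),
        half_abs_label_sub, lossDecrease]
      -- Coverage is a common factor of numerator and denominator and cancels, leaving only the
      -- accuracy of the extended source.
      · rw [voteFactor_eq_mul _ _ ht, voteFactor_eq_mul (a' i) (c' i) (t := -ext ω) (by simpa using ht),
          mul_assoc, mul_assoc, ← mul_add, mul_div_mul_left _ _ (h'.1 i).2.2.1.ne']
        ring
      · have p1 := mul_pos (voteFactor_pos (h'.1 i) (ext ω))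
          (h.otherFactor_pos i 1 (otherVotes V i ω))
        have p2 := mul_pos (voteFactor_pos (h'.1 i) (-ext ω))
          (h.otherFactor_pos i (-1) (otherVotes V i ω))
        refine ⟨by positivity, ?_⟩
        rw [div_le_one (by positivity)]
        linarith
  · have e1 : extendedModel P Y V i ext ω = labelModel P Y V ω := by
      simp [extendedModel, h0]
    rw [e1, if_neg (by simp [h0]), sub_self]

theorem HasFactorLaw.lift_eq_sum (h : HasFactorLaw P Y V a c)
    (h' : HasFactorLaw P Y (Function.update V i ext) a' c')
    (hY : ∀ y, MeasurableSet (Y ⁻¹' {y})) (hV : ∀ j s, MeasurableSet (V j ⁻¹' {s}))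
    (hext : ∀ s, MeasurableSet (ext ⁻¹' {s})) (hk : ∀ ω, V i ω ≠ 0 → ext ω = V i ω)
    (hb : P.real {ω | Y ω = 1} = 1 / 2) :
    risk P Y (labelModel P Y V) - risk P Y (extendedModel P Y V i ext) =
      ∑ y : ℤˣ, ∑ t ∈ ({-1, 1} : Finset SignType), ∑ u, 1 / 2 * otherFactor a c i y u *
        (voteFactor (a' i) (c' i) (relVote y t) - voteFactor (a i) (c i) (relVote y t)) *
        lossDecrease a c i (a' i) y t u := by
  have hW := measurableSet_preimage_prodMk hY (measurableSet_preimage_prodMk (hV i)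
    (measurableSet_preimage_prodMk hext (measurableSet_otherVotes hV i)))
  rw [h.lift_eq_integral h' hY hV hext hb, integral_finiteValued P hW fun w =>
    if w.2.1 = 0 ∧ w.2.2.1 ≠ 0 then lossDecrease a c i (a' i) w.1 w.2.2.1 w.2.2.2 else 0]
  simp only [Fintype.sum_prod_type]
  refine Finset.sum_congr rfl fun y _ => ?_
  rw [Finset.sum_eq_single 0 (fun s _ hs => by simp [hs])
    (fun hs => absurd (Finset.mem_univ _) hs)]
  rw [← Finset.sum_subset (Finset.subset_univ ({-1, 1} : Finset SignType))]
  · refine Finset.sum_congr rfl fun t ht => Finset.sum_congr rfl fun u _ => ?_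
    have ht0 : t ≠ 0 := by rintro rfl; revert ht; decide
    rw [h.newRegion_law h' hY hV hext hk y ht0, if_pos ⟨rfl, ht0⟩]
  · intro t _ ht
    have : t = 0 := by revert ht; cases t <;> decide
    simp [this]

/-- Lower bound of the lift in terms of the mass `b` of the new region and the mass `d` of the
correct new votes. -/
theorem HasFactorLaw.le_lift (h : HasFactorLaw P Y V a c)
    (h' : HasFactorLaw P Y (Function.update V i ext) a' c')
    (hY : ∀ y, MeasurableSet (Y ⁻¹' {y})) (hV : ∀ j s, MeasurableSet (V j ⁻¹' {s}))
    (hext : ∀ s, MeasurableSet (ext ⁻¹' {s})) (hk : ∀ ω, V i ω ≠ 0 → ext ω = V i ω)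
    (hb : P.real {ω | Y ω = 1} = 1 / 2) {b d : ℝ} (hcb : c' i = c i + b)
    (hd : a' i * c' i = a i * c i + d) (hd0 : 0 ≤ d) (hdb : d ≤ b) :
    d * a' i + (b - d) * (1 - a' i) - b * othersPerformance P Y V i ≤
      risk P Y (labelModel P Y V) - risk P Y (extendedModel P Y V i ext) := by
  obtain ⟨-, -, hC⟩ := h.othersPerformance_bounds hY hV i
  set C := othersPerformance P Y V i
  set R := otherFactor a c i 1
  set S := otherFactor a c i (-1)
  have hα := h'.1 i
  -- By the label symmetry both sums equal `E[p(X) | Y = 1]`, which is at most `C`.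
  have hflip : ∑ u, S u ^ 2 / (R u + S u) = ∑ u, R u ^ 2 / (R u + S u) := by
    rw [← sum_comp_neg_votes]
    refine Finset.sum_congr rfl fun u _ => ?_
    simp only [R, S, otherFactor_neg, neg_neg]
    rw [add_comm]
  have hsq : ∑ u, (R u ^ 2 + S u ^ 2) / (R u + S u) ≤ 2 * C := by
    have : ∑ u, R u ^ 2 / (R u + S u) ≤ C := by
      refine le_trans (le_of_eq (Finset.sum_congr rfl fun u _ => ?_)) hC
      rw [otherProb]
      ring
    simp only [add_div, Finset.sum_add_distrib]
    linarith
  have hlift : risk P Y (labelModel P Y V) - risk P Y (extendedModel P Y V i ext) =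
      ∑ u, 1 / 2 * (R u * d * (a' i * R u / (a' i * R u + (1 - a' i) * S u) - R u / (R u + S u)) +
      R u * (b - d) * ((1 - a' i) * R u / ((1 - a' i) * R u + a' i * S u) - R u / (R u + S u)) +
      S u * (b - d) * (R u / (R u + S u) - a' i * R u / (a' i * R u + (1 - a' i) * S u)) +
      S u * d * (R u / (R u + S u) - (1 - a' i) * R u / ((1 - a' i) * R u + a' i * S u))) := by
    rw [h.lift_eq_sum h' hY hV hext hk hb, sum_units_int,
      Finset.sum_pair (by decide), Finset.sum_pair (by decide), ← Finset.sum_add_distrib,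
      ← Finset.sum_add_distrib, ← Finset.sum_add_distrib]
    refine Finset.sum_congr rfl fun u _ => ?_
    have e1 : a' i * c' i - a i * c i = d := by linarith
    have e2 : (1 - a' i) * c' i - (1 - a i) * c i = b - d := by
      rw [← e1]; linear_combination hcb
    have n1 : ((-1 : ℤˣ) = 1) = False := by decide
    have n2 : ((-1 : SignType) = 1) = False := by decide
    have n3 : ((1 : SignType) = -1) = False := by decide
    simp only [relVote, voteFactor, lossDecrease, otherProb, n1, n2, n3, if_true, if_false, neg_neg,
      e1, e2, Units.val_neg, Units.val_one, Int.cast_neg, Int.cast_one, mul_one, one_mul, R, S]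
    ring
  rw [hlift]
  have hpt : ∀ u, 1 / 2 * ((d * a' i + (b - d) * (1 - a' i)) * (R u + S u) -
      (d + (b - d)) * ((R u ^ 2 + S u ^ 2) / (R u + S u))) ≤ _ := fun u =>
    mul_le_mul_of_nonneg_left (le_posterior_gain (h.otherFactor_pos i 1 u)
      (h.otherFactor_pos i (-1) u) hd0 (sub_nonneg.2 hdb) hα.1 hα.2.1) (by norm_num)
  refine le_trans ?_ (Finset.sum_le_sum fun u _ => hpt u)
  rw [← Finset.mul_sum, Finset.sum_sub_distrib, ← Finset.mul_sum, ← Finset.mul_sum,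
    Finset.sum_add_distrib, sum_otherFactor, sum_otherFactor]
  have hb0 : 0 ≤ b := hd0.trans hdb
  have := mul_le_mul_of_nonneg_left hsq hb0
  linarith

end Lift

/-! ### Mass of the new region. -/

section NewRegion

variable {Ω 𝒳 𝒵 : Type*} [MeasurableSpace Ω] [MetricSpace 𝒵] {P : Measure Ω}
  {X : Ω → 𝒳} {g : 𝒳 → 𝒵} {r : ℝ} {lf : 𝒳 → SignType} {ext : Ω → SignType}

theorem IsExtension.newRegion_eq {Ω 𝒳 𝒵 : Type*} [MetricSpace 𝒵] {X : Ω → 𝒳} {g : 𝒳 → 𝒵}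
    {r : ℝ} {lf : 𝒳 → SignType} {ext : Ω → SignType} (h : IsExtension X g r lf ext) :
    {ω | X ω ∈ newRegion g r lf} = {ω | lf (X ω) = 0 ∧ ext ω ≠ 0} := by
  ext ω
  refine ⟨fun hω => ⟨hω.1, h.votes ω hω⟩, fun ⟨h0, h1⟩ => ?_⟩
  by_contra hn
  exact h1 (h.abstains ω h0 hn)

/-- Close pairs across the boundary of the support put their first point into the new region. -/
theorem IsSupportLowerLipschitz.mul_closeProb_le [IsProbabilityMeasure P] {L : ℝ → ℝ}
    (hL : IsSupportLowerLipschitz P X g lf L) (hr : 0 < r)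
    (hclose : MeasurableSet (closePairs X g r)) :
    L r * closeProb P X g r ≤
      P.real {ω | X ω ∈ newRegion g r lf} * coverage P fun ω => lf (X ω) := by
  by_cases h0 : closeProb P X g r = 0
  · rw [h0, mul_zero]
    exact mul_nonneg measureReal_nonneg measureReal_nonneg
  · have h1 := hL.2 r hr h0
    rw [measureReal_cond_eq _ hclose] at h1
    change L r ≤ (closeProb P X g r)⁻¹ * _ at h1
    have hpos : 0 < closeProb P X g r := lt_of_le_of_ne measureReal_nonneg (Ne.symm h0)
    have h2 := mul_le_mul_of_nonneg_right h1 hpos.le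
    rw [mul_comm (closeProb P X g r)⁻¹, inv_mul_cancel_right₀ h0] at h2
    refine h2.trans ?_
    rw [coverage, ← measureReal_prod_prod]
    -- A close pair with only its second point in the support lies in the product of the new region
    -- and the support; independence of the two points turns its measure into a product.
    refine measureReal_mono ?_
    rintro ⟨ω, ω'⟩ ⟨hd, h3, h4⟩
    exact ⟨⟨h3, X ω', h4, hd⟩, h4⟩

end NewRegion

end Epoxy

end

/-! ### Assembly of the three claims. -/

theorem theorem1 {Ω 𝒳 𝒵 : Type*} [MeasurableSpace Ω] [MeasurableSpace 𝒳] [MetricSpace 𝒵]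
    (P : Measure Ω) [IsProbabilityMeasure P]
    (X : Ω → 𝒳) (hX : Measurable X)
    (Y : Ω → ℤˣ) (hY : ∀ y, MeasurableSet (Y ⁻¹' {y}))
    (hbalanced : P.real {ω | Y ω = 1} = 1 / 2)
    (g : 𝒳 → 𝒵) (hg : Measurable fun q : 𝒳 × 𝒳 => dist (g q.1) (g q.2))
    (m : ℕ) (lf : Fin m → 𝒳 → SignType) (hlf : ∀ j s, MeasurableSet (lf j ⁻¹' {s}))
    (hising : Epoxy.IsIsing P Y fun j ω => lf j (X ω))
    (LY MY : ℝ → ℝ) (hYLip : Epoxy.IsLabelLipschitz P X g Y LY MY)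
    (L : Fin m → ℝ → ℝ) (hL : ∀ j, Epoxy.IsSupportLowerLipschitz P X g (lf j) (L j)) :
    -- estimation error with all sources extended
    (3 ≤ m → ∀ (r : Fin m → ℝ), (∀ j, 0 < r j) →
      ∀ (ext : Fin m → Ω → SignType), (∀ j s, MeasurableSet (ext j ⁻¹' {s})) →
      (∀ j, Epoxy.IsExtension X g (r j) (lf j) (ext j)) →
      Epoxy.IsIsing P Y ext →
      ∀ (t : Fin m → Fin m × Fin m), Epoxy.IsTripletChoice P ext t →
      ∀ (emin c₁ : ℝ), 0 < emin → (∀ j, emin ≤ Epoxy.signedAccuracy P Y (ext j)) →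
      0 < c₁ → (∀ j k, j ≠ k → c₁ ≤ Epoxy.moment P (ext j) (ext k)) →
      ∀ (n : ℕ) (δ : ℝ), 1 ≤ n → 0 < δ → δ < 1 →
      Epoxy.epsn δ n < Epoxy.minPatternProb P ext →
      Epoxy.EstimationErrorAtMost P Y ext t n δ
        (1 / (Epoxy.minPatternProb P ext - Epoxy.epsn δ n) *
          (81 * Real.sqrt Real.pi / (2 * emin * c₁ ^ 2) *
              (m / Real.sqrt (n * (Epoxy.minOverlap P (fun j ω => lf j (X ω)) *
                (1 + (2 * (⨅ j, L j (r j)) - (⨅ j, L j (r j)) ^ 2) *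
                  Epoxy.closeProb P X g (⨅ j, r j))))) +
            Epoxy.epsn δ n * Epoxy.meanLabelProb P Y ext))) ∧
    -- estimation error with the original sources
    (3 ≤ m →
      ∀ (t : Fin m → Fin m × Fin m), Epoxy.IsTripletChoice P (fun j ω => lf j (X ω)) t →
      ∀ (emin c₁ : ℝ), 0 < emin →
      (∀ j, emin ≤ Epoxy.signedAccuracy P Y fun ω => lf j (X ω)) →
      0 < c₁ →
      (∀ j k, j ≠ k → c₁ ≤ Epoxy.moment P (fun ω => lf j (X ω)) fun ω => lf k (X ω)) →
      ∀ (n : ℕ) (δ : ℝ), 1 ≤ n → 0 < δ → δ < 1 →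
      Epoxy.epsn δ n < Epoxy.minPatternProb P (fun j ω => lf j (X ω)) →
      Epoxy.EstimationErrorAtMost P Y (fun j ω => lf j (X ω)) t n δ
        (1 / (Epoxy.minPatternProb P (fun j ω => lf j (X ω)) - Epoxy.epsn δ n) *
          (81 * Real.sqrt Real.pi / (2 * emin * c₁ ^ 2) *
              (m / Real.sqrt (n * Epoxy.minOverlap P fun j ω => lf j (X ω))) +
            Epoxy.epsn δ n * Epoxy.meanLabelProb P Y fun j ω => lf j (X ω)))) ∧
    -- asymptotic lift from extending the source `i`
    (∀ (i : Fin m) (r : ℝ), 0 < r →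
      ∀ (ext : Ω → SignType), (∀ s, MeasurableSet (ext ⁻¹' {s})) →
      Epoxy.IsExtension X g r (lf i) ext →
      Epoxy.IsIsing P Y (Function.update (fun j ω => lf j (X ω)) i ext) →
      ∀ (p pd a abar atilde C lift : ℝ),
      p = Epoxy.coverage P (fun ω => lf i (X ω)) →
      pd = Epoxy.closeProb P X g r →
      a = Epoxy.accuracy P Y (fun ω => lf i (X ω)) →
      abar = Epoxy.accuracy P Y ext →
      atilde = Epoxy.newAccuracy P X Y g r (lf i) ext →
      C = Epoxy.othersPerformance P Y (fun j ω => lf j (X ω)) i →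
      lift = Epoxy.risk P Y (Epoxy.labelModel P Y fun j ω => lf j (X ω)) -
        Epoxy.risk P Y (Epoxy.extendedModel P Y (fun j ω => lf j (X ω)) i ext) →
      P.real {ω | X ω ∈ Epoxy.newRegion g r (lf i)} * Epoxy.liftFactor C atilde abar ≤ lift ∧
      (0 ≤ Epoxy.liftFactor C atilde abar →
        L i r * pd * p * Epoxy.liftFactor C atilde abar ≤ lift) ∧
      -- accuracy on the new region, for a weighting rule with the guarantee on `abar`
      (1 / 2 ≤ a → 0 < L i r * pd →
        a - (2 * a - 1) * (MY r / (p ^ 2 * (1 + L i r * pd))) ≤ abar →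
        abar - (2 * a - 1) * (MY r / (L i r * pd * p ^ 2 * (1 + L i r * pd))) ≤ atilde)) := by
  have hV : ∀ j s, MeasurableSet ((fun ω => lf j (X ω)) ⁻¹' {s}) := fun j s => hX (hlf j s)
  obtain ⟨α, γ, h⟩ := hising.exists_hasFactorLaw hY hV hbalanced
  refine ⟨?_, ?_, ?_⟩
  · intro hm r _ ext hext _ hisingE t ht emin c₁ he hea hc₁ hcm n δ hn hδ hδ1 hε
    obtain ⟨α', γ', h'⟩ := hisingE.exists_hasFactorLaw hY hext hbalanced
    obtain ⟨ho0, ho1⟩ := h.minOverlap_mem hY hV hm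
    have hne : Nonempty (Fin m) := ⟨⟨0, by omega⟩⟩
    obtain ⟨i, hi⟩ := exists_eq_ciInf_of_finite (f := fun j => L j (r j))
    obtain ⟨hl0, hl1⟩ := (hL i).1 (r i)
    rw [hi] at hl0 hl1
    generalize (⨅ j, L j (r j)) = l at *
    have hp0 : 0 ≤ Epoxy.closeProb P X g (⨅ j, r j) := measureReal_nonneg
    have hp1 : Epoxy.closeProb P X g (⨅ j, r j) ≤ 1 := measureReal_le_one
    generalize Epoxy.closeProb P X g (⨅ j, r j) = pd at *
    have hq0 : 0 ≤ 2 * l - l ^ 2 := by nlinarith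
    have hq1 : 2 * l - l ^ 2 ≤ 1 := by nlinarith [sq_nonneg (l - 1)]
    have hf0 : 0 ≤ (2 * l - l ^ 2) * pd := mul_nonneg hq0 hp0
    have hf1 : (2 * l - l ^ 2) * pd ≤ 1 := mul_le_one₀ hq1 hp0 hp1
    -- `o_min ≤ 1` and an extension factor between `1` and `2` place their product in `(0, 2]`, as
    -- the rate comparison needs.
    exact h'.estimationErrorAtMost hY hext hbalanced hm ht he hea hc₁ hcm hn hδ hδ1 hε
      (mul_pos ho0 (by linarith)) (by nlinarith)
  · intro hm t ht emin c₁ he hea hc₁ hcm n δ hn hδ hδ1 hε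
    obtain ⟨ho0, ho1⟩ := h.minOverlap_mem hY hV hm
    exact h.estimationErrorAtMost hY hV hbalanced hm ht he hea hc₁ hcm hn hδ hδ1 hε ho0
      (by linarith)
  · intro i r hr ext hext hE hisingE p pd a abar atilde C lift hp hpd ha habar hatilde hC hlift
    have hV' := Epoxy.measurableSet_update (i := i) hV hext
    obtain ⟨α', γ', h'⟩ := hisingE.exists_hasFactorLaw hY hV' hbalanced
    have hk : ∀ ω, lf i (X ω) ≠ 0 → ext ω = lf i (X ω) := hE.keeps
    have hclose : MeasurableSet (Epoxy.closePairs X g r) :=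
      (hg.comp ((hX.comp measurable_fst).prodMk (hX.comp measurable_snd))) measurableSet_Iic
    have hcov := Epoxy.coverage_extension (P := P) (hV i) hext hk
    have hcor := Epoxy.correct_extension (P := P) hY (hV i) hext hk
    have hLp := (hL i).mul_closeProb_le hr hclose
    have hregion : MeasurableSet {ω | lf i (X ω) = 0 ∧ ext ω ≠ 0} :=
      Epoxy.measurableSet_finiteValued (Epoxy.measurableSet_preimage_prodMk (hV i) hext)
        fun s => s.1 = 0 ∧ s.2 ≠ 0
    have hnew : atilde = (P.real {ω | lf i (X ω) = 0 ∧ ext ω ≠ 0})⁻¹ *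
        P.real ({ω | lf i (X ω) = 0 ∧ ext ω ≠ 0} ∩
          {ω | ((ext ω : SignType) : ℤ) = (Y ω : ℤ)}) := by
      rw [hatilde, Epoxy.newAccuracy, hE.newRegion_eq, Epoxy.measureReal_cond_eq P hregion]
    have hdb : P.real ({ω | lf i (X ω) = 0 ∧ ext ω ≠ 0} ∩
          {ω | ((ext ω : SignType) : ℤ) = (Y ω : ℤ)}) ≤
        P.real {ω | lf i (X ω) = 0 ∧ ext ω ≠ 0} := measureReal_mono Set.inter_subset_left
    have hd0 : 0 ≤ P.real ({ω | lf i (X ω) = 0 ∧ ext ω ≠ 0} ∩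
          {ω | ((ext ω : SignType) : ℤ) = (Y ω : ℤ)}) := measureReal_nonneg
    rw [hE.newRegion_eq, ← hpd, ← hp] at hLp
    rw [hE.newRegion_eq]
    rw [← hp] at hcov
    rw [← habar, ← ha, ← hp] at hcor
    generalize P.real ({ω | lf i (X ω) = 0 ∧ ext ω ≠ 0} ∩
          {ω | ((ext ω : SignType) : ℤ) = (Y ω : ℤ)}) = d at *
    generalize P.real {ω | lf i (X ω) = 0 ∧ ext ω ≠ 0} = b at *
    have hb0 : 0 ≤ b := hd0.trans hdb
    have hα' : α' i = abar := by
      rw [habar, ← h'.accuracy_eq hY hV' i, Function.update_self]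
    have hγ' : γ' i = Epoxy.coverage P ext := by
      rw [← h'.coverage_eq hY hV' i, Function.update_self]
    have hα : α i = a := by rw [ha, ← h.accuracy_eq hY hV i]
    have hγ : γ i = p := by rw [hp, ← h.coverage_eq hY hV i]
    have hle := h.le_lift h' hY hV hext hk hbalanced (b := b) (d := d)
      (by rw [hγ', hγ, hcov]) (by rw [hα', hγ', hα, hγ, hcor]) hd0 hdb
    obtain ⟨hC1, hC0, -⟩ := h.othersPerformance_bounds hY hV i
    rw [← hlift, ← hC, hα'] at hle
    rw [← hC] at hC1 hC0
    obtain ⟨hp0, hp1⟩ : 0 < p ∧ p < 1 := hγ ▸ (h.1 i).2.2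
    obtain ⟨habar0, habar1⟩ : 0 < abar ∧ abar < 1 := hα' ▸ ⟨(h'.1 i).1, (h'.1 i).2.1⟩
    -- If the region is null, the conditional accuracy is a default value, but `d ≤ b = 0` saves the
    -- identity.
    have hbd : b * atilde = d := by
      rw [hnew]
      by_cases hb : b = 0
      · rw [hb, zero_mul]; linarith
      · rw [mul_inv_cancel_left₀ hb]
    -- The bound of `HasFactorLaw.le_lift` has coefficient `1` where the claim has `(C + 1) / 2 ≤
    -- 1`, in front of a nonnegative term.
    have hmain : b * Epoxy.liftFactor C atilde abar ≤ lift := by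
      refine le_trans ?_ hle
      have e : b * Epoxy.liftFactor C atilde abar =
          1 / 2 * (C + 1) * (d * abar + (b - d) * (1 - abar)) - b * C := by
        rw [← hbd, Epoxy.liftFactor]; ring
      have hT : 0 ≤ d * abar + (b - d) * (1 - abar) :=
        add_nonneg (mul_nonneg hd0 habar0.le)
          (mul_nonneg (sub_nonneg.2 hdb) (sub_nonneg.2 habar1.le))
      rw [e]
      have := mul_le_mul_of_nonneg_right (show 1 / 2 * (C + 1) ≤ 1 by linarith) hT
      linarith
    have hLpp : L i r * pd * p ≤ b := by
      have h1 := mul_le_mul_of_nonneg_right hLp hp0.le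
      have h2 := mul_le_of_le_one_right hb0 (mul_le_one₀ hp1.le hp0.le hp1.le)
      linarith
    refine ⟨hmain, fun hD => (mul_le_mul_of_nonneg_right hLpp hD).trans hmain, ?_⟩
    intro ha2 hLpos hrule
    set l := L i r * pd
    have hbpos : 0 < b := pos_of_mul_pos_left (hLpos.trans_le hLp) hp0.le
    have hM : 0 ≤ MY r := (hYLip.1 r).2.1
    have hgap : 0 ≤ (2 * a - 1) * (MY r / (p ^ 2 * (1 + l))) :=
      mul_nonneg (by linarith) (by positivity)
    have hlp : p * l ≤ b := by rw [mul_comm]; exact hLpp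
    have e : (2 * a - 1) * (MY r / (l * p ^ 2 * (1 + l))) =
        (2 * a - 1) * (MY r / (p ^ 2 * (1 + l))) / l := by
      field_simp
    set G := (2 * a - 1) * (MY r / (p ^ 2 * (1 + l)))
    -- Counting correct votes: `abar * (p + b) = a * p + atilde * b`.
    have hcor' : b * (atilde - abar) = p * (abar - a) := by
      rw [hcov] at hcor
      linear_combination hbd - hcor
    -- The loss guaranteed by the rule is amplified by at most `p / b ≤ 1 / l` when it is all
    -- attributed to the new region.
    have h1 : -(b * (G / l)) ≤ -(p * G) := by
      have : p * G ≤ b * (G / l) := by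
        rw [mul_div_assoc', le_div_iff₀ hLpos]
        have := mul_le_mul_of_nonneg_right hlp hgap
        linarith
      linarith
    have h2 : -(p * G) ≤ p * (abar - a) := by
      have := mul_le_mul_of_nonneg_left (show -G ≤ abar - a by linarith) hp0.le
      linarith
    have h3 : b * (-(G / l)) ≤ b * (atilde - abar) := by rw [hcor']; linarith
    have h4 := le_of_mul_le_mul_left h3 hbpos
    rw [e]
    linarith
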